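/- Let $\mathbb T=\{z\in\mathbb C:|z|=1\}$ with normalised Lebesgue measure $\mathrm m$. For $\alpha\in\mathbb R$ let $\mathbb A_\alpha$ be the noncommutative 2-torus, i.e. the universal unital $C^*$-algebra generated by two unitaries $U,V$ subject to $UV=e^{2\pi i\alpha}VU$, and let $\tau$ be its canonical trace, the state with $\tau(U^mV^n)=\delta_{m,0}\delta_{n,0}$ for $m,n\in\mathbb Z$. Let $f:\mathbb T\to\mathbb T$ be continuous and let $\theta\in\mathbb R$ be such that $\theta/2\pi$ is irrational. The Anzai skew-product $\Phi_{\theta,f}$ is the $*$-automorphism of $\mathbb A_\alpha$ determined by $\Phi_{\theta,f}(U)=e^{i\theta}U$ and $\Phi_{\theta,f}(V)=f(U)V$. Write $R_a z=e^{2\pi i a}z$ and put $$f_n=\prod_{l=0}^{n-1}f\circ R_{-l\alpha}\ (n>0),\qquad f_0=1,\qquad f_n=\prod_{l=1}^{|n|}\overline{f\circ R_{l\alpha}}\ (n<0).$$ Then the following are equivalent: (i) $\tau$ is ergodic for $\Phi_{\theta,f}$, i.e. $\tau$ is an extreme point of the convex set of $\Phi_{\theta,f}$-invariant states of $\mathbb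 A_\alpha$; (ii) for each $n\in\mathbb Z\setminus\{0\}$ the cohomological equation $(g\circ R_{\theta/2\pi})\,f_n=g$ (almost everywhere) has no nonzero solution $g\in L^2(\mathbb T,\mathrm m)$; (iii) $(\mathbb A_\alpha,\Phi_{\theta,f})$ is uniquely ergodic, i.e. there is exactly one $\Phi_{\theta,f}$-invariant state on $\mathbb A_\alpha$. -/

import Mathlib

noncomputable section
open scoped ComplexOrder

/-- The free unital complex `*`-algebra on two unitary indeterminates: the group algebra of the free
group on two generators, with `(a g)^* = conj a g⁻¹`. -/
def PreTorus (_α : ℝ) : Type := MonoidAlgebra ℂ (FreeGroup Bool)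

namespace PreTorus

variable (α : ℝ)

instance : Ring (PreTorus α) := inferInstanceAs (Ring (MonoidAlgebra ℂ (FreeGroup Bool)))
instance : Algebra ℂ (PreTorus α) :=
  inferInstanceAs (Algebra ℂ (MonoidAlgebra ℂ (FreeGroup Bool)))

/-- The monomial `a g`. -/
def mono (g : FreeGroup Bool) (a : ℂ) : PreTorus α := MonoidAlgebra.single g a

variable {α}

theorem mono_mul_mono (g h : FreeGroup Bool) (a b : ℂ) :
    mono α g a * mono α h b = mono α (g * h) (a * b) :=
  MonoidAlgebra.single_mul_single g h a b

theorem one_def : (1 : PreTorus α) = mono α 1 1 := rfl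

theorem mono_add (g : FreeGroup Bool) (a b : ℂ) :
    mono α g (a + b) = mono α g a + mono α g b := MonoidAlgebra.single_add g a b

theorem smul_mono (c : ℂ) (g : FreeGroup Bool) (a : ℂ) :
    c • mono α g a = mono α g (c * a) := MonoidAlgebra.smul_single c g a

theorem induction {P : PreTorus α → Prop} (x : PreTorus α) (zero : P 0)
    (add : ∀ x y, P x → P y → P (x + y)) (mono : ∀ g a, P (mono α g a)) : P x :=
  MonoidAlgebra.induction_linear x zero add mono

/-- The involution, as an additive map. -/
def starHom (α : ℝ) : PreTorus α →+ PreTorus α :=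
  MonoidAlgebra.liftNC (R := PreTorus α)
    ((algebraMap ℂ (PreTorus α)).toAddMonoidHom.comp (starAddEquiv (R := ℂ)).toAddMonoidHom)
    (fun g => mono α g⁻¹ 1)

theorem starHom_mono (g : FreeGroup Bool) (a : ℂ) :
    starHom α (mono α g a) = mono α g⁻¹ (star a) := by
  refine (MonoidAlgebra.liftNC_single _ _ g a).trans ?_
  change algebraMap ℂ (PreTorus α) (star a) * mono α g⁻¹ 1 = _
  rw [← Algebra.smul_def, smul_mono, mul_one]

instance : StarRing (PreTorus α) where
  star := starHom α
  star_involutive x := by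
    induction x using induction with
    | zero => simp
    | add x y hx hy => simp [hx, hy]
    | mono g a => simp [starHom_mono]
  star_mul x y := by
    change starHom α (x * y) = starHom α y * starHom α x
    induction x using induction with
    | zero => simp
    | add x x' hx hx' => simp [add_mul, mul_add, hx, hx']
    | mono g a =>
      induction y using induction with
      | zero => simp
      | add y y' hy hy' => simp [add_mul, mul_add, hy, hy']
      | mono h b => simp [starHom_mono, mono_mul_mono, mul_comm]
  star_add x y := map_add (starHom α) x y

theorem star_mono (g : FreeGroup Bool) (a : ℂ) : star (mono α g a) = mono α g⁻¹ (star a) :=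
  starHom_mono g a

instance : StarModule ℂ (PreTorus α) where
  star_smul c x := by
    induction x using induction with
    | zero => simp
    | add x y hx hy => simp only [smul_add, star_add, hx, hy]
    | mono g a => simp [star_mono, smul_mono]

variable (α) in
/-- The first unitary indeterminate. -/
def u : PreTorus α := mono α (FreeGroup.of true) 1

variable (α) in
/-- The second unitary indeterminate. -/
def v : PreTorus α := mono α (FreeGroup.of false) 1

/-- The `C^*`-seminorms on the free `*`-algebra on two unitaries `u`, `v` that are compatible with
the relation `u v = e^{2 π i α} v u`. -/
structure IsCStarSeminorm (p : Seminorm ℂ (PreTorus α)) : Prop where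
  mul_le : ∀ x y, p (x * y) ≤ p x * p y
  star_mul_self : ∀ x, p (star x * x) = p x ^ 2
  relation : p (u α * v α - Complex.exp (2 * Real.pi * Complex.I * α) • (v α * u α)) = 0

theorem IsCStarSeminorm.mono_le {p : Seminorm ℂ (PreTorus α)} (hp : IsCStarSeminorm p)
    (g : FreeGroup Bool) (a : ℂ) : p (mono α g a) ≤ ‖a‖ := by
  have h1 : p (mono α 1 1) ≤ 1 := by
    have := hp.star_mul_self (mono α 1 1)
    simp only [star_mono, mono_mul_mono, inv_one, star_one, mul_one] at this
    nlinarith [apply_nonneg p (mono α 1 1)]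
  have hg : p (mono α g 1) ≤ 1 := by
    have := hp.star_mul_self (mono α g 1)
    simp only [star_mono, mono_mul_mono, inv_mul_cancel, star_one, mul_one] at this
    nlinarith [apply_nonneg p (mono α g 1)]
  have : mono α g a = a • mono α g 1 := by rw [smul_mono, mul_one]
  rw [this, map_smul_eq_mul]
  exact mul_le_of_le_one_right (norm_nonneg a) hg

theorem exists_bound (x : PreTorus α) :
    ∃ C : ℝ, ∀ p : Seminorm ℂ (PreTorus α), IsCStarSeminorm p → p x ≤ C := by
  induction x using induction with
  | zero => exact ⟨0, fun p _ => by simp⟩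
  | add x y hx hy =>
    obtain ⟨C, hC⟩ := hx
    obtain ⟨D, hD⟩ := hy
    exact ⟨C + D, fun p hp => (map_add_le_add p x y).trans (add_le_add (hC p hp) (hD p hp))⟩
  | mono g a => exact ⟨‖a‖, fun p hp => hp.mono_le g a⟩

theorem isCStarSeminorm_zero : IsCStarSeminorm (0 : Seminorm ℂ (PreTorus α)) where
  mul_le := by simp
  star_mul_self := by simp
  relation := by simp

/-- The universal `C^*`-seminorm: the largest `C^*`-seminorm compatible with the relation. -/
instance : Norm (PreTorus α) where
  norm x := ⨆ p : {p : Seminorm ℂ (PreTorus α) // IsCStarSeminorm p}, p.1 x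

theorem norm_def (x : PreTorus α) :
    ‖x‖ = ⨆ p : {p : Seminorm ℂ (PreTorus α) // IsCStarSeminorm p}, p.1 x := rfl

theorem IsCStarSeminorm.le_norm {p : Seminorm ℂ (PreTorus α)} (hp : IsCStarSeminorm p)
    (x : PreTorus α) : p x ≤ ‖x‖ := by
  obtain ⟨C, hC⟩ := exists_bound x
  exact le_ciSup (f := fun p : {p : Seminorm ℂ (PreTorus α) // IsCStarSeminorm p} => p.1 x)
    ⟨C, by rintro _ ⟨q, rfl⟩; exact hC q.1 q.2⟩ ⟨p, hp⟩

theorem norm_le_of {x : PreTorus α} {C : ℝ}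
    (h : ∀ p : Seminorm ℂ (PreTorus α), IsCStarSeminorm p → p x ≤ C) : ‖x‖ ≤ C :=
  haveI : Nonempty {p : Seminorm ℂ (PreTorus α) // IsCStarSeminorm p} :=
    ⟨⟨0, isCStarSeminorm_zero⟩⟩
  ciSup_le fun p => h p.1 p.2

theorem norm_nonneg' (x : PreTorus α) : 0 ≤ ‖x‖ :=
  (apply_nonneg (0 : Seminorm ℂ (PreTorus α)) x).trans (isCStarSeminorm_zero.le_norm x)

instance : SeminormedRing (PreTorus α) :=
  RingSeminorm.toSeminormedRing
    { toFun := fun x => ‖x‖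
      map_zero' := le_antisymm (norm_le_of fun p _ => by simp) (norm_nonneg' 0)
      add_le' := fun x y => norm_le_of fun p hp =>
        (map_add_le_add p x y).trans (add_le_add (hp.le_norm x) (hp.le_norm y))
      neg' := fun x => by simp [norm_def]
      mul_le' := fun x y => norm_le_of fun p hp => (hp.mul_le x y).trans
        (mul_le_mul (hp.le_norm x) (hp.le_norm y) (apply_nonneg p y) (norm_nonneg' x)) }

instance : NormedAlgebra ℂ (PreTorus α) where
  norm_smul_le c x := norm_le_of fun p hp => by
    rw [map_smul_eq_mul]
    exact mul_le_mul_of_nonneg_left (hp.le_norm x) (norm_nonneg c)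

theorem norm_mul_self_le (x : PreTorus α) : ‖x‖ * ‖x‖ ≤ ‖star x * x‖ := by
  have : ‖x‖ ≤ Real.sqrt ‖star x * x‖ := norm_le_of fun p hp =>
    Real.le_sqrt_of_sq_le ((hp.star_mul_self x).symm.le.trans (hp.le_norm _))
  calc ‖x‖ * ‖x‖ ≤ Real.sqrt ‖star x * x‖ * Real.sqrt ‖star x * x‖ :=
        mul_self_le_mul_self (norm_nonneg' x) this
    _ = _ := Real.mul_self_sqrt (norm_nonneg' _)

theorem norm_star_le (x : PreTorus α) : ‖star x‖ ≤ ‖x‖ := by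
  have h := (norm_mul_self_le (star x)).trans (norm_mul_le (star (star x)) (star x))
  rw [star_star] at h
  by_contra hlt
  push Not at hlt
  nlinarith [norm_nonneg' x]

instance : NormedStarGroup (PreTorus α) where
  norm_star_le := norm_star_le

theorem norm_mono_le (g : FreeGroup Bool) (a : ℂ) : ‖mono α g a‖ ≤ ‖a‖ :=
  norm_le_of fun _ hp => hp.mono_le g a

theorem relation_norm :
    ‖u α * v α - Complex.exp (2 * Real.pi * Complex.I * α) • (v α * u α)‖ = 0 :=
  le_antisymm (norm_le_of fun _ hp => hp.relation.le) (norm_nonneg' _)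

end PreTorus

/-- The noncommutative torus `𝔸_α`: the universal unital `C^*`-algebra generated by two unitaries
`U`, `V` with `U V = e^{2 π i α} V U`, as the (separated) completion of the free `*`-algebra on two
unitaries for its universal `C^*`-seminorm. See `NCTorus.lift` and `NCTorus.hom_ext` for the
universal property. -/
def NCTorus (α : ℝ) : Type := UniformSpace.Completion (PreTorus α)

namespace NCTorus
open UniformSpace

variable {α : ℝ}

instance : NormedRing (NCTorus α) := inferInstanceAs (NormedRing (Completion (PreTorus α)))
instance : CompleteSpace (NCTorus α) :=
  inferInstanceAs (CompleteSpace (Completion (PreTorus α)))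
instance instAlgebra : Algebra ℂ (NCTorus α) :=
  inferInstanceAs (Algebra ℂ (Completion (PreTorus α)))
instance : NormedAlgebra ℂ (NCTorus α) where
  __ := instAlgebra
  norm_smul_le c x := norm_smul_le (β := Completion (PreTorus α)) c x
/-- The canonical map from the free `*`-algebra. -/
def mk (x : PreTorus α) : NCTorus α := Completion.coe' x

theorem continuous_mk : Continuous (mk : PreTorus α → NCTorus α) :=
  Completion.continuous_coe _
theorem norm_mk (x : PreTorus α) : ‖mk x‖ = ‖x‖ := Completion.norm_coe x
theorem mk_add (x y : PreTorus α) : mk (x + y) = mk x + mk y := Completion.coe_add x y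
theorem mk_mul (x y : PreTorus α) : mk (x * y) = mk x * mk y := Completion.coe_mul x y
theorem mk_one : mk (1 : PreTorus α) = 1 := rfl
theorem mk_smul (c : ℂ) (x : PreTorus α) : mk (c • x) = c • mk x := Completion.coe_smul c x

theorem denseRange_mk : DenseRange (mk : PreTorus α → NCTorus α) := Completion.denseRange_coe

theorem induction {P : NCTorus α → Prop} (x : NCTorus α) (hc : IsClosed {x | P x})
    (h : ∀ y, P (mk y)) : P x := Completion.induction_on x hc h

/-- The involution, extended by continuity. -/
def starFun (x : NCTorus α) : NCTorus α :=
  Completion.map (star : PreTorus α → PreTorus α) x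

theorem continuous_starFun : Continuous (starFun : NCTorus α → NCTorus α) :=
  Completion.continuous_map

theorem starFun_mk (x : PreTorus α) : starFun (mk x) = mk (star x) :=
  Completion.map_coe (starₗᵢ ℂ : PreTorus α ≃ₗᵢ⋆[ℂ] PreTorus α).isometry.uniformContinuous x

instance : StarRing (NCTorus α) where
  star := starFun
  star_involutive x := by
    induction x using induction with
    | hc => exact isClosed_eq (continuous_starFun.comp continuous_starFun) continuous_id
    | h x => simp [starFun_mk]
  star_mul x y := by
    change starFun (x * y) = starFun y * starFun x
    induction x using induction with
    | hc =>
      exact isClosed_eq (continuous_starFun.comp (continuous_id.mul continuous_const))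
        (continuous_const.mul continuous_starFun)
    | h x =>
      induction y using induction with
      | hc =>
        exact isClosed_eq (continuous_starFun.comp (continuous_const.mul continuous_id))
          (continuous_starFun.mul continuous_const)
      | h y => rw [← mk_mul, starFun_mk, starFun_mk, starFun_mk, star_mul, mk_mul]
  star_add x y := by
    change starFun (x + y) = starFun x + starFun y
    induction x using induction with
    | hc =>
      exact isClosed_eq (continuous_starFun.comp (continuous_id.add continuous_const))
        (continuous_starFun.add continuous_const)
    | h x =>
      induction y using induction with
      | hc =>
        exact isClosed_eq (continuous_starFun.comp (continuous_const.add continuous_id))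
          (continuous_const.add continuous_starFun)
      | h y => rw [← mk_add, starFun_mk, starFun_mk, starFun_mk, star_add, mk_add]

theorem star_mk (x : PreTorus α) : star (mk x) = mk (star x) := starFun_mk x

instance : CStarAlgebra (NCTorus α) where
  norm_mul_self_le x := by
    induction x using induction with
    | hc =>
      exact isClosed_le (continuous_norm.mul continuous_norm)
        (continuous_norm.comp (continuous_starFun.mul continuous_id))
    | h x =>
      rw [star_mk, ← mk_mul, norm_mk, norm_mk]
      exact PreTorus.norm_mul_self_le x
  star_smul c x := by
    induction x using induction with
    | hc =>
      exact isClosed_eq (continuous_starFun.comp (continuous_const_smul c))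
        (continuous_starFun.const_smul (star c))
    | h x => rw [← mk_smul, star_mk, star_mk, ← mk_smul, star_smul]

end NCTorus

namespace PreTorus

variable {α : ℝ} {D : Type*} [CStarAlgebra D]

/-- The unital homomorphism from the free `*`-algebra on two unitaries determined by a pair of
unitaries of `D`. -/
def liftAlgHom (α : ℝ) (a b : unitary D) : PreTorus α →ₐ[ℂ] D :=
  MonoidAlgebra.lift ℂ D (FreeGroup Bool)
    ((unitary D).subtype.comp (FreeGroup.lift fun i => if i then a else b))

theorem liftAlgHom_mono (a b : unitary D) (g : FreeGroup Bool) (c : ℂ) :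
    liftAlgHom α a b (mono α g c) =
      c • ((FreeGroup.lift (fun i => if i then a else b) g : unitary D) : D) :=
  MonoidAlgebra.lift_single _ _ _

/-- `liftAlgHom` as a `*`-homomorphism. -/
def lift (α : ℝ) (a b : unitary D) : PreTorus α →⋆ₐ[ℂ] D where
  toAlgHom := liftAlgHom α a b
  map_star' x := by
    change liftAlgHom α a b (star x) = star (liftAlgHom α a b x)
    induction x using induction with
    | zero => simp
    | add x y hx hy => rw [star_add, map_add, map_add, star_add, hx, hy]
    | mono g c => rw [star_mono, liftAlgHom_mono, liftAlgHom_mono, map_inv, star_smul]; rfl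

theorem lift_mono (a b : unitary D) (g : FreeGroup Bool) (c : ℂ) :
    lift α a b (mono α g c) =
      c • ((FreeGroup.lift (fun i => if i then a else b) g : unitary D) : D) :=
  liftAlgHom_mono a b g c

theorem lift_u (a b : unitary D) : lift α a b (u α) = a := by simp [u, lift_mono]

theorem lift_v (a b : unitary D) : lift α a b (v α) = b := by simp [v, lift_mono]

theorem norm_lift_le (a b : unitary D)
    (h : (a : D) * b = Complex.exp (2 * Real.pi * Complex.I * α) • ((b : D) * a))
    (x : PreTorus α) : ‖lift α a b x‖ ≤ ‖x‖ := by
  have hp : IsCStarSeminorm ((normSeminorm ℂ D).comp (lift α a b).toAlgHom.toLinearMap) :=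
    { mul_le := fun x y => by simpa using norm_mul_le (lift α a b x) (lift α a b y)
      star_mul_self := fun x => by
        simpa [map_star, sq] using CStarRing.norm_star_mul_self (x := lift α a b x)
      relation := by simp [lift_u, lift_v, h] }
  exact hp.le_norm x

end PreTorus

namespace NCTorus

variable {D : Type*} [CStarAlgebra D] {α : ℝ}

variable (α) in
/-- The unitary `U` of `𝔸_α`. -/
def U : unitary (NCTorus α) :=
  ⟨mk (PreTorus.u α), by
    rw [Unitary.mem_iff, star_mk, ← mk_mul, ← mk_mul]
    simp [PreTorus.u, PreTorus.star_mono, PreTorus.mono_mul_mono, ← PreTorus.one_def, mk_one]⟩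

variable (α) in
/-- The unitary `V` of `𝔸_α`. -/
def V : unitary (NCTorus α) :=
  ⟨mk (PreTorus.v α), by
    rw [Unitary.mem_iff, star_mk, ← mk_mul, ← mk_mul]
    simp [PreTorus.v, PreTorus.star_mono, PreTorus.mono_mul_mono, ← PreTorus.one_def, mk_one]⟩

/-- The defining commutation relation `U V = e^{2 π i α} V U`. -/
theorem U_mul_V : (U α : NCTorus α) * V α =
    Complex.exp (2 * Real.pi * Complex.I * α) • ((V α : NCTorus α) * U α) := by
  have h : ‖mk (PreTorus.u α * PreTorus.v α -
      Complex.exp (2 * Real.pi * Complex.I * α) • (PreTorus.v α * PreTorus.u α))‖ = 0 := by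
    rw [norm_mk, PreTorus.relation_norm]
  rw [norm_eq_zero, sub_eq_add_neg, ← neg_smul, mk_add, mk_smul, mk_mul, mk_mul, neg_smul,
    ← sub_eq_add_neg, sub_eq_zero] at h
  exact h

theorem continuous_preLift (a b : unitary D)
    (h : (a : D) * b = Complex.exp (2 * Real.pi * Complex.I * α) • ((b : D) * a)) :
    Continuous (PreTorus.lift α a b : PreTorus α →+* D) :=
  (AddMonoidHomClass.lipschitz_of_bound (PreTorus.lift α a b) 1 fun x => by
    simpa using PreTorus.norm_lift_le a b h x).continuous

/-- The universal property of `𝔸_α`: two unitaries of a unital `C^*`-algebra that satisfy the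
commutation relation define a unital `*`-homomorphism. -/
def lift (a b : unitary D)
    (h : (a : D) * b = Complex.exp (2 * Real.pi * Complex.I * α) • ((b : D) * a)) :
    NCTorus α →⋆ₐ[ℂ] D :=
  let φ : UniformSpace.Completion (PreTorus α) →+* D :=
    UniformSpace.Completion.extensionHom (PreTorus.lift α a b : PreTorus α →+* D)
      (continuous_preLift a b h)
  have hφ : ∀ x : PreTorus α, φ (mk x) = PreTorus.lift α a b x :=
    UniformSpace.Completion.extensionHom_coe _ (continuous_preLift a b h)
  have hφc : Continuous φ := UniformSpace.Completion.continuous_extension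
  { toFun := φ
    map_one' := φ.map_one
    map_mul' := φ.map_mul
    map_zero' := φ.map_zero
    map_add' := φ.map_add
    commutes' := fun r => (hφ (algebraMap ℂ (PreTorus α) r)).trans
      ((PreTorus.lift α a b).toAlgHom.commutes r)
    map_star' := fun x => by
      induction x using induction with
      | hc => exact isClosed_eq (hφc.comp continuous_star) (continuous_star.comp hφc)
      | h x => rw [star_mk, hφ, hφ, map_star] }

theorem lift_mk (a b : unitary D)
    (h : (a : D) * b = Complex.exp (2 * Real.pi * Complex.I * α) • ((b : D) * a))
    (x : PreTorus α) : lift a b h (mk x) = PreTorus.lift α a b x :=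
  UniformSpace.Completion.extensionHom_coe _ (continuous_preLift a b h) x

theorem lift_U (a b : unitary D)
    (h : (a : D) * b = Complex.exp (2 * Real.pi * Complex.I * α) • ((b : D) * a)) :
    lift a b h (U α) = a := (lift_mk a b h _).trans (PreTorus.lift_u a b)

theorem lift_V (a b : unitary D)
    (h : (a : D) * b = Complex.exp (2 * Real.pi * Complex.I * α) • ((b : D) * a)) :
    lift a b h (V α) = b := (lift_mk a b h _).trans (PreTorus.lift_v a b)

/-- The uniqueness part of the universal property. -/
theorem hom_ext {φ ψ : NCTorus α →⋆ₐ[ℂ] D} (hU : φ (U α) = ψ (U α)) (hV : φ (V α) = ψ (V α)) :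
    φ = ψ := by
  have key : ∀ g : FreeGroup Bool, φ (mk (PreTorus.mono α g 1)) = ψ (mk (PreTorus.mono α g 1)) := by
    have hmul : ∀ g h : FreeGroup Bool, mk (PreTorus.mono α (g * h) 1) =
        mk (PreTorus.mono α g 1) * mk (PreTorus.mono α h 1) := fun g h => by
      rw [← mk_mul, PreTorus.mono_mul_mono, mul_one]
    have hinv : ∀ g : FreeGroup Bool, mk (PreTorus.mono α g⁻¹ 1) =
        star (mk (PreTorus.mono α g 1)) := fun g => by
      rw [star_mk, PreTorus.star_mono, star_one]
    intro g
    induction g using FreeGroup.induction_on with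
    | C1 => rw [← PreTorus.one_def, mk_one, map_one, map_one]
    | of i => cases i; exacts [hV, hU]
    | inv_of i hi => rw [hinv, map_star, map_star, hi]
    | mul g h hg hh => rw [hmul, map_mul, map_mul, hg, hh]
  have hφ : Continuous φ := (AddMonoidHomClass.lipschitz_of_bound φ 1 fun x => by
    simpa using NonUnitalStarAlgHom.norm_apply_le φ x).continuous
  have hψ : Continuous ψ := (AddMonoidHomClass.lipschitz_of_bound ψ 1 fun x => by
    simpa using NonUnitalStarAlgHom.norm_apply_le ψ x).continuous
  ext x
  induction x using induction with
  | hc => exact isClosed_eq hφ hψ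
  | h x =>
    induction x using PreTorus.induction with
    | zero =>
      have : mk (0 : PreTorus α) = 0 := by rw [← zero_smul ℂ (0 : PreTorus α), mk_smul, zero_smul]
      rw [this, map_zero, map_zero]
    | add x y hx hy => rw [mk_add, map_add, map_add, hx, hy]
    | mono g c =>
      have : PreTorus.mono α g c = c • PreTorus.mono α g 1 := by rw [PreTorus.smul_mono, mul_one]
      rw [this, mk_smul, map_smul, map_smul, key]

end NCTorus

/-! ### The canonical trace -/

section Regular

/-- The Hilbert space `ℓ²(ℤ × ℤ)`. -/
abbrev EllTwo : Type := lp (fun _ : ℤ × ℤ => ℂ) 2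

/-- The unitary operator `(W x) i = c i * x (e i)` on `ℓ²(ℤ × ℤ)`, for a bijection `e` of `ℤ × ℤ` and
phases `c`. -/
def weightedShift (c : ℤ × ℤ → Circle) (e : ℤ × ℤ ≃ ℤ × ℤ) : EllTwo →ₗᵢ[ℂ] EllTwo where
  toFun x := ⟨fun i => (c i : ℂ) * x (e i), by
    change Memℓp (fun i => (c i : ℂ) * x (e i)) 2
    have hx := lp.memℓp x
    rw [memℓp_gen_iff (by norm_num)] at hx ⊢
    simp only [norm_mul, Circle.norm_coe, one_mul]
    exact (e.summable_iff (f := fun i => ‖x i‖ ^ (2 : ENNReal).toReal)).2 hx⟩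
  map_add' x y := by ext i; exact mul_add _ _ _
  map_smul' a x := by ext i; exact mul_left_comm _ _ _
  norm_map' x := by
    rw [lp.norm_eq_tsum_rpow (by norm_num), lp.norm_eq_tsum_rpow (by norm_num)]
    congr 1
    change ∑' i, ‖(c i : ℂ) * x (e i)‖ ^ (2 : ENNReal).toReal = _
    simp only [norm_mul, Circle.norm_coe, one_mul]
    exact e.tsum_eq (fun i => ‖x i‖ ^ (2 : ENNReal).toReal)

theorem weightedShift_apply (c : ℤ × ℤ → Circle) (e : ℤ × ℤ ≃ ℤ × ℤ) (x : EllTwo) (i : ℤ × ℤ) :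
    weightedShift c e x i = (c i : ℂ) * x (e i) := rfl

/-- `weightedShift` as a unitary element of `B(ℓ²(ℤ × ℤ))`. -/
def weightedShiftUnitary (c : ℤ × ℤ → Circle) (e : ℤ × ℤ ≃ ℤ × ℤ) :
    unitary (EllTwo →L[ℂ] EllTwo) :=
  Unitary.linearIsometryEquiv.symm
    (LinearIsometryEquiv.ofSurjective (weightedShift c e) fun x =>
      ⟨weightedShift (fun i => (c (e.symm i))⁻¹) e.symm x, by
        ext i
        simp [weightedShift_apply]⟩)

theorem weightedShiftUnitary_apply (c : ℤ × ℤ → Circle) (e : ℤ × ℤ ≃ ℤ × ℤ) (x : EllTwo)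
    (i : ℤ × ℤ) :
    (weightedShiftUnitary c e : EllTwo →L[ℂ] EllTwo) x i = (c i : ℂ) * x (e i) := rfl

/-- The operator `(U x) (m, n) = x (m - 1, n)`, that is `δ_{m, n} ↦ δ_{m + 1, n}`. -/
def regularU : unitary (EllTwo →L[ℂ] EllTwo) :=
  weightedShiftUnitary (fun _ => 1) ((Equiv.subRight 1).prodCongr (Equiv.refl ℤ))

/-- The operator `(V x) (m, n) = e^{- 2 π i α m} x (m, n - 1)`, that is
`δ_{m, n} ↦ e^{- 2 π i α m} δ_{m, n + 1}`. -/
def regularV (α : ℝ) : unitary (EllTwo →L[ℂ] EllTwo) :=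
  weightedShiftUnitary (fun i => Circle.exp (-(2 * Real.pi * α * i.1)))
    ((Equiv.refl ℤ).prodCongr (Equiv.subRight 1))

theorem regularU_apply (x : EllTwo) (m n : ℤ) :
    (regularU : EllTwo →L[ℂ] EllTwo) x (m, n) = x (m - 1, n) := by
  simp [regularU, weightedShiftUnitary_apply]

theorem regularV_apply (α : ℝ) (x : EllTwo) (m n : ℤ) :
    (regularV α : EllTwo →L[ℂ] EllTwo) x (m, n) =
      Circle.exp (-(2 * Real.pi * α * m)) * x (m, n - 1) := by
  simp [regularV, weightedShiftUnitary_apply]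

theorem regularU_zpow_apply (k : ℤ) (x : EllTwo) (m n : ℤ) :
    ((regularU ^ k : unitary (EllTwo →L[ℂ] EllTwo)) : EllTwo →L[ℂ] EllTwo) x (m, n) =
      x (m - k, n) := by
  induction k using Int.induction_on generalizing x m n with
  | zero => simp
  | succ k ih =>
    rw [zpow_add_one, Submonoid.coe_mul, mul_apply_eq_comp, ih, regularU_apply, sub_sub]
  | pred k ih =>
    rw [zpow_sub_one, Submonoid.coe_mul, mul_apply_eq_comp, ih]
    obtain ⟨y, rfl⟩ : ∃ y, (regularU : EllTwo →L[ℂ] EllTwo) y = x :=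
      ⟨((regularU⁻¹ : unitary (EllTwo →L[ℂ] EllTwo)) : EllTwo →L[ℂ] EllTwo) x, by
        rw [← mul_apply_eq_comp, ← Submonoid.coe_mul, mul_inv_cancel]; rfl⟩
    rw [← mul_apply_eq_comp, ← Submonoid.coe_mul, inv_mul_cancel, regularU_apply,
      show m - (-(k : ℤ) - 1) - 1 = m - -(k : ℤ) by ring]
    rfl

theorem regularV_zpow_apply (α : ℝ) (k : ℤ) (x : EllTwo) (m n : ℤ) :
    ((regularV α ^ k : unitary (EllTwo →L[ℂ] EllTwo)) : EllTwo →L[ℂ] EllTwo) x (m, n) =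
      (Circle.exp (-(2 * Real.pi * α * m)) ^ k : Circle) * x (m, n - k) := by
  induction k using Int.induction_on generalizing x m n with
  | zero => simp
  | succ k ih =>
    rw [zpow_add_one, Submonoid.coe_mul, mul_apply_eq_comp, ih, regularV_apply, zpow_add_one,
      sub_sub, Circle.coe_mul]
    exact (mul_assoc _ _ _).symm
  | pred k ih =>
    rw [zpow_sub_one, Submonoid.coe_mul, mul_apply_eq_comp, ih]
    obtain ⟨y, rfl⟩ : ∃ y, (regularV α : EllTwo →L[ℂ] EllTwo) y = x :=
      ⟨(((regularV α)⁻¹ : unitary (EllTwo →L[ℂ] EllTwo)) : EllTwo →L[ℂ] EllTwo) x, by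
        rw [← mul_apply_eq_comp, ← Submonoid.coe_mul, mul_inv_cancel]; rfl⟩
    rw [← mul_apply_eq_comp, ← Submonoid.coe_mul, inv_mul_cancel, regularV_apply, zpow_sub_one,
      show n - (-(k : ℤ) - 1) - 1 = n - -(k : ℤ) by ring]
    generalize Circle.exp (-(2 * Real.pi * α * m)) = c
    change _ * y (m, n - -(k : ℤ)) = _
    rw [Circle.coe_mul, Circle.coe_inv]
    field_simp [Circle.coe_ne_zero c]

theorem regular_relation (α : ℝ) :
    (regularU : EllTwo →L[ℂ] EllTwo) * regularV α =
      Complex.exp (2 * Real.pi * Complex.I * α) •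
        ((regularV α : EllTwo →L[ℂ] EllTwo) * regularU) := by
  ext x ⟨m, n⟩
  simp only [mul_apply_eq_comp, smul_apply, lp.coeFn_smul,
    Pi.smul_apply, regularU_apply, regularV_apply, smul_eq_mul, Circle.coe_exp, ← mul_assoc,
    ← Complex.exp_add]
  congr 2
  push_cast
  ring

end Regular

namespace NCTorus

/-- The representation of `𝔸_α` on `ℓ²(ℤ × ℤ)` (the GNS representation of the canonical trace, with
`δ_{m, n}` in the role of `U^m V^n ξ`). -/
def regularRep (α : ℝ) : NCTorus α →⋆ₐ[ℂ] (EllTwo →L[ℂ] EllTwo) :=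
  lift regularU (regularV α) (regular_relation α)

/-- The canonical trace `τ (a) = ⟨δ_{0, 0}, π (a) δ_{0, 0}⟩`. -/
def trace (α : ℝ) : NCTorus α →L[ℂ] ℂ :=
  LinearMap.mkContinuous
    { toFun := fun a => inner ℂ (lp.single 2 (0, 0) 1 : EllTwo)
        (regularRep α a (lp.single 2 (0, 0) 1))
      map_add' := fun a b => by simp
      map_smul' := fun c a => by simp } 1 fun a => by
    have h1 : ‖(lp.single 2 (0, 0) 1 : EllTwo)‖ = 1 := by simp
    have h2 : ‖regularRep α a‖ ≤ ‖a‖ := NonUnitalStarAlgHom.norm_apply_le _ a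
    calc _ ≤ ‖(lp.single 2 (0, 0) 1 : EllTwo)‖ * ‖regularRep α a (lp.single 2 (0, 0) 1)‖ :=
          norm_inner_le_norm _ _
      _ ≤ 1 * (‖a‖ * 1) := by
          rw [h1]
          gcongr
          refine ((regularRep α a).le_opNorm _).trans ?_
          rw [h1]
          gcongr
      _ = 1 * ‖a‖ := by ring

theorem trace_apply (α : ℝ) (a : NCTorus α) :
    trace α a = regularRep α a (lp.single 2 (0, 0) 1) (0, 0) := by
  refine (lp.inner_single_left (𝕜 := ℂ) _ _ _).trans ?_
  simp

/-- The formula `τ (U^m V^n) = δ_{m, 0} δ_{n, 0}`. -/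
theorem trace_U_zpow_mul_V_zpow (α : ℝ) (m n : ℤ) :
    trace α (((U α ^ m : unitary (NCTorus α)) : NCTorus α) *
      ((V α ^ n : unitary (NCTorus α)) : NCTorus α)) = if m = 0 ∧ n = 0 then 1 else 0 := by
  have key : ∀ (a : unitary (NCTorus α)) (b : unitary (EllTwo →L[ℂ] EllTwo)) (k : ℤ),
      regularRep α a = b → regularRep α ((a ^ k : unitary (NCTorus α)) : NCTorus α) =
        ((b ^ k : unitary (EllTwo →L[ℂ] EllTwo)) : EllTwo →L[ℂ] EllTwo) := by
    intro a b k h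
    have h' : Unitary.map
        ({ toFun := regularRep α
           map_one' := map_one _
           map_mul' := map_mul _
           map_star' := map_star _ } : NCTorus α →⋆* (EllTwo →L[ℂ] EllTwo)) a = b := Subtype.ext h
    rw [← h', ← map_zpow]
    rfl
  rw [trace_apply, map_mul, key _ _ m (lift_U _ _ _), key _ _ n (lift_V _ _ _),
    mul_apply_eq_comp, regularU_zpow_apply, regularV_zpow_apply]
  by_cases hm : m = 0 <;> by_cases hn : n = 0 <;> simp [hm, hn, lp.single_apply]

end NCTorus

/-! ### The Anzai skew-product -/

section CircleCalculus

variable {A : Type*} [CStarAlgebra A]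

theorem continuous_circle_coe : Continuous fun z : Circle => (z : ℂ) := continuous_subtype_val

/-- The inclusion of the spectrum of a unitary into the unit circle. -/
def spectrumToCircle (u : unitary A) : C(spectrum ℂ (u : A), Circle) where
  toFun z := ⟨z, spectrum.subset_circle_of_unitary u.2 z.2⟩
  continuous_toFun := continuous_subtype_val.subtype_mk _

/-- The continuous functional calculus `C(𝕋) → A`, `g ↦ g (u)`, of a unitary `u`. -/
def circleCalculus (u : unitary A) : C(Circle, ℂ) →⋆ₐ[ℂ] A :=
  (cfcHom (R := ℂ) (p := IsStarNormal) (a := (u : A)) inferInstance).comp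
    (ContinuousMap.compStarAlgHom' ℂ ℂ (spectrumToCircle u))

/-- The functional calculus sends the coordinate function to `u`. -/
theorem circleCalculus_coe (u : unitary A) :
    circleCalculus u ⟨fun z => (z : ℂ), continuous_circle_coe⟩ = u :=
  cfcHom_id (R := ℂ) (p := IsStarNormal) (a := (u : A)) inferInstance

/-- The unitary `f (u)` for continuous `f : 𝕋 → 𝕋`. -/
def circleApply (f : C(Circle, Circle)) (u : unitary A) : unitary A :=
  ⟨circleCalculus u ⟨fun z => (f z : ℂ), continuous_circle_coe.comp f.continuous⟩, by
    rw [Unitary.mem_iff, ← map_star, ← map_mul, ← map_mul]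
    constructor
    · convert map_one (circleCalculus u)
      ext z
      simp [← Circle.coe_inv_eq_conj]
    · convert map_one (circleCalculus u)
      ext z
      simp [← Circle.coe_inv_eq_conj]⟩

/-- The unitary `c u` for `c ∈ 𝕋`. -/
def rotateUnitary (c : Circle) (u : unitary A) : unitary A :=
  ⟨(c : ℂ) • (u : A), by
    rw [Unitary.mem_iff, star_smul, smul_mul_smul_comm, smul_mul_smul_comm]
    simp [← Circle.coe_inv_eq_conj]⟩

theorem commute_circleApply (f : C(Circle, Circle)) (u : unitary A) :
    Commute (u : A) (circleApply f u) := by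
  conv_lhs => rw [← circleCalculus_coe u]
  change _ * circleCalculus u _ = circleCalculus u _ * _
  rw [← map_mul, ← map_mul, mul_comm]

end CircleCalculus

namespace NCTorus

theorem anzai_relation (α θ : ℝ) (f : C(Circle, Circle)) :
    ((rotateUnitary (Circle.exp θ) (U α) : unitary (NCTorus α)) : NCTorus α) *
        (circleApply f (U α) * V α : unitary (NCTorus α)) =
      Complex.exp (2 * Real.pi * Complex.I * α) •
        (((circleApply f (U α) * V α : unitary (NCTorus α)) : NCTorus α) *
          (rotateUnitary (Circle.exp θ) (U α) : unitary (NCTorus α))) := by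
  have h : ((U α : NCTorus α) * circleApply f (U α)) = circleApply f (U α) * (U α : NCTorus α) :=
    commute_circleApply f (U α)
  change ((Circle.exp θ : ℂ) • (U α : NCTorus α)) * ((circleApply f (U α) : NCTorus α) * V α) =
    _ • (((circleApply f (U α) : NCTorus α) * V α) * ((Circle.exp θ : ℂ) • (U α : NCTorus α)))
  rw [smul_mul_assoc, ← mul_assoc, h, mul_assoc, U_mul_V, mul_smul_comm, mul_smul_comm, smul_comm]
  simp only [mul_assoc]

/-- The Anzai skew-product `Φ_{θ, f}`: the unital `*`-homomorphism `𝔸_α → 𝔸_α` with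
`U ↦ e^{i θ} U` and `V ↦ f (U) V` (which is an automorphism, as `f (U)` is unitary). -/
def anzai (α θ : ℝ) (f : C(Circle, Circle)) : NCTorus α →⋆ₐ[ℂ] NCTorus α :=
  lift (rotateUnitary (Circle.exp θ) (U α)) (circleApply f (U α) * V α) (anzai_relation α θ f)

theorem anzai_U (α θ : ℝ) (f : C(Circle, Circle)) :
    anzai α θ f (U α) = (Circle.exp θ : ℂ) • (U α : NCTorus α) := lift_U _ _ _

theorem anzai_V (α θ : ℝ) (f : C(Circle, Circle)) :
    anzai α θ f (V α) = (circleApply f (U α) : NCTorus α) * V α := lift_V _ _ _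

end NCTorus

/-! ### Invariant states, ergodicity and the cohomological equations -/

section States

variable {A : Type*} [CStarAlgebra A]

/-- The states of a unital `C^*`-algebra: positive functionals with `φ 1 = 1`. -/
def states (A : Type*) [CStarAlgebra A] : Set (A →L[ℂ] ℂ) :=
  {φ | φ 1 = 1 ∧ ∀ a, 0 ≤ φ (star a * a)}

/-- The states that are invariant under `Φ`. -/
def invariantStates (Φ : A →⋆ₐ[ℂ] A) : Set (A →L[ℂ] ℂ) :=
  {φ | φ ∈ states A ∧ ∀ a, φ (Φ a) = φ a}

/-- An ergodic state for `Φ` is an extreme point of the convex set of invariant states. -/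
def IsErgodicState (Φ : A →⋆ₐ[ℂ] A) (φ : A →L[ℂ] ℂ) : Prop :=
  φ ∈ Set.extremePoints ℝ (invariantStates Φ)

/-- `(A, Φ)` is uniquely ergodic if there is exactly one invariant state. -/
def IsUniquelyErgodic (Φ : A →⋆ₐ[ℂ] A) : Prop := ∃! φ, φ ∈ invariantStates Φ

end States

namespace Circle

instance : MeasurableSpace Circle := borel Circle
instance : BorelSpace Circle := ⟨rfl⟩

/-- The normalised Lebesgue measure `dz / (2 π i z)` on the circle: the image of the normalised Haar
measure of `ℝ / ℤ` under `x ↦ e^{2 π i x}`. -/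
def lebesgue : MeasureTheory.Measure Circle :=
  (AddCircle.haarAddCircle (T := 1)).map AddCircle.toCircle

instance : MeasureTheory.IsProbabilityMeasure lebesgue :=
  MeasureTheory.Measure.isProbabilityMeasure_map
    (AddCircle.continuous_toCircle (T := 1)).measurable.aemeasurable

/-- The rotation `R_a z = e^{2 π i a} z`. -/
def rot (a : ℝ) (z : Circle) : Circle := Circle.exp (2 * Real.pi * a) * z

end Circle

/-- The functions `f_n`, with `f_n (U) V^n = (f (U) V)^n`. -/
def cocycle (α : ℝ) (f : C(Circle, Circle)) : ℤ → Circle → ℂ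
  | Int.ofNat n => fun z => ∏ l ∈ Finset.range n, (f (Circle.rot (-(l * α)) z) : ℂ)
  | Int.negSucc k => fun z =>
      ∏ l ∈ Finset.Icc 1 (k + 1), starRingEnd ℂ (f (Circle.rot (l * α) z) : ℂ)

/-- The cohomological equation `(g ∘ R_{θ / 2 π}) f_n = g` in `L²(𝕋)`. -/
def SolvesCohomological (α θ : ℝ) (f : C(Circle, Circle)) (n : ℤ)
    (g : MeasureTheory.Lp ℂ 2 Circle.lebesgue) : Prop :=
  (fun z => g (Circle.rot (θ / (2 * Real.pi)) z) * cocycle α f n z) =ᵐ[Circle.lebesgue] g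

end

/-! The elements `h(U) V^n`, with `h` continuous on the circle, span a dense subspace of `𝔸_α`, and
the skew-product maps the `n`-th fibre `{h(U) V^n}` to itself by `h ↦ (h ∘ R_{θ/2π}) f_n`
(`anzai_term`). Both nontrivial implications are read off fibre by fibre.

No solutions implies unique ergodicity. On the fibre `n = 0` an invariant state `φ` is invariant
under an irrational rotation, hence is Lebesgue integration. Cauchy–Schwarz then gives `|φ(h(U)
V^n)| ≤ ‖h‖₂`, so by Riesz `φ` is `⟨g, ·⟩` on the `n`-th fibre for some `g ∈ L²`
(`exists_apply_term_eq_inner`). Invariance of `φ` is the weak form of the `n`-th cohomological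
equation for `g` (`solvesCohomological_iff`), so `g = 0` for `n ≠ 0` and `φ = τ`.

Unique ergodicity implies ergodicity, because the only point of a one-point set is extreme.

Ergodicity implies no solutions. Let `g` be a unit solution for some `n ≠ 0`. Irrationality makes
`|g|²` constant, so the vector `x = g(U) V^n Ω` of the regular representation, `Ω` being the cyclic
vector, again has vector state `τ` (`coeff_embed_eq_trace`). Moreover `x ⟂ Ω`, and `⟨x, π(·)Ω⟩` is
invariant. The vector states of `(Ω ± x)/√2` are therefore invariant with midpoint `τ`, and they
differ on the `n`-th fibre, so `τ` is not extreme. -/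

noncomputable section
open MeasureTheory
open scoped ComplexOrder ComplexConjugate

/-! ### Rotations, monomials and Lebesgue measure on the circle. -/

namespace Circle

/-- The rotation `R_a` as a continuous map. -/
def rotMap (a : ℝ) : C(Circle, Circle) := ⟨rot a, by unfold rot; fun_prop⟩

theorem rotMap_apply (a : ℝ) (z : Circle) : rotMap a z = rot a z := rfl

theorem rot_rot (a b : ℝ) (z : Circle) : rot a (rot b z) = rot (a + b) z := by
  simp only [rot, mul_add, Circle.exp_add, mul_assoc]

theorem rot_zero (z : Circle) : rot 0 z = z := by simp [rot]

/-- The monomial `z ↦ z ^ k`. -/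
def monomial (k : ℤ) : C(Circle, ℂ) :=
  ⟨fun z => ((z ^ k : Circle) : ℂ), continuous_circle_coe.comp (continuous_zpow k)⟩

theorem monomial_apply (k : ℤ) (z : Circle) : monomial k z = ((z ^ k : Circle) : ℂ) := rfl

theorem monomial_zero : monomial 0 = 1 := by ext z; simp [monomial_apply]

theorem star_monomial (k : ℤ) : star (monomial k) = monomial (-k) := by
  ext z
  simp [monomial_apply, ← Circle.coe_inv_eq_conj]

theorem monomial_add (k l : ℤ) : monomial (k + l) = monomial k * monomial l := by
  ext z; simp [monomial_apply, zpow_add]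

theorem monomial_comp_rotMap (k : ℤ) (a : ℝ) :
    (monomial k).comp (rotMap a) = ((Circle.exp (2 * Real.pi * a) ^ k : Circle) : ℂ) • monomial k := by
  ext z
  simp [monomial_apply, rotMap_apply, rot, mul_zpow]

/-- The form in which irrationality is used: a quantity multiplied by this factor and left unchanged
must vanish, which kills the nontrivial Fourier coefficients of anything invariant. -/
theorem exp_zpow_ne_one {a : ℝ} (ha : Irrational a) {k : ℤ} (hk : k ≠ 0) :
    ((Circle.exp (2 * Real.pi * a) ^ k : Circle) : ℂ) ≠ 1 := by
  rw [← Circle.exp_zsmul, Circle.coe_exp, Ne, Complex.exp_eq_one_iff]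
  rintro ⟨n, hn⟩
  have h : (k : ℝ) * a = n := by
    have h2 : ((2 * Real.pi * Complex.I : ℂ)) ≠ 0 := by simp [Real.pi_ne_zero]
    have : ((k * a : ℝ) : ℂ) = (n : ℂ) := by
      apply mul_right_cancel₀ h2
      rw [← hn]; push_cast [zsmul_eq_mul]; ring
    exact_mod_cast this
  exact (ha.intCast_mul hk).ne_int n h

/-- Composition with a continuous self-map of the circle, as a continuous linear map. -/
def compCLM (r : C(Circle, Circle)) : C(Circle, ℂ) →L[ℂ] C(Circle, ℂ) where
  toLinearMap := (ContinuousMap.compStarAlgHom' ℂ ℂ r).toAlgHom.toLinearMap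
  cont := ContinuousMap.continuous_precomp r

/-- Continuous linear maps on `C(𝕋)` that agree on the monomials are equal. -/
theorem clm_ext {E : Type*} [NormedAddCommGroup E] [NormedSpace ℂ E] {F G : C(Circle, ℂ) →L[ℂ] E}
    (h : ∀ k, F (monomial k) = G (monomial k)) : F = G := by
  -- Density of trigonometric polynomials is known on `ℝ / ℤ`; `T` transports it to the circle.
  let e : AddCircle (1 : ℝ) ≃ₜ Circle := AddCircle.homeomorphCircle one_ne_zero
  let T : C(AddCircle (1 : ℝ), ℂ) →L[ℂ] C(Circle, ℂ) :=
    { toLinearMap := (ContinuousMap.compStarAlgHom' ℂ ℂ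
        (⟨e.symm, e.symm.continuous⟩ : C(Circle, AddCircle (1 : ℝ)))).toAlgHom.toLinearMap
      cont := ContinuousMap.continuous_precomp _ }
  have hT : ∀ k, T (fourier k) = monomial k := by
    intro k
    ext z
    obtain ⟨x, rfl⟩ := e.surjective z
    change fourier k (e.symm (e x)) = _
    rw [e.symm_apply_apply, monomial_apply, fourier_apply, AddCircle.toCircle_zsmul,
      AddCircle.homeomorphCircle_apply]
  have key : F ∘L T = G ∘L T := by
    refine ContinuousLinearMap.ext_on (s := Set.range (@fourier 1)) ?_ ?_
    · exact Submodule.dense_iff_topologicalClosure_eq_top.2 span_fourier_closure_eq_top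
    · rintro _ ⟨k, rfl⟩
      simp [hT, h]
  ext p
  have hp : p = T (p.comp ⟨e, e.continuous⟩) := by
    ext z
    change _ = p (e (e.symm z))
    rw [e.apply_symm_apply]
  rw [hp]
  exact DFunLike.congr_fun key _

theorem rot_toCircle (a : ℝ) (x : AddCircle (1 : ℝ)) :
    rot a (AddCircle.toCircle x) = AddCircle.toCircle ((a : AddCircle (1 : ℝ)) + x) := by
  rw [AddCircle.toCircle_add, AddCircle.toCircle_apply_mk, rot, div_one]

theorem measurePreserving_rot (a : ℝ) : MeasurePreserving (rot a) lebesgue lebesgue := by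
  have hm : Measurable (rot a) := (rotMap a).continuous.measurable
  have ht : Measurable (AddCircle.toCircle (T := 1)) := AddCircle.continuous_toCircle.measurable
  refine ⟨hm, ?_⟩
  rw [lebesgue, Measure.map_map hm ht]
  have : rot a ∘ AddCircle.toCircle (T := 1) =
      AddCircle.toCircle ∘ ((a : AddCircle (1 : ℝ)) + ·) := funext (rot_toCircle a)
  rw [this, ← Measure.map_map ht (measurable_const_add _), map_add_left_eq_self]

theorem integral_comp_rot {E : Type*} [NormedAddCommGroup E] [NormedSpace ℝ E] (a : ℝ)
    (F : Circle → E) : ∫ z, F (rot a z) ∂lebesgue = ∫ z, F z ∂lebesgue := by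
  refine (measurePreserving_rot a).integral_comp ?_ F
  refine (Homeomorph.measurableEmbedding
    { toFun := rot a, invFun := rot (-a), left_inv := fun z => ?_, right_inv := fun z => ?_,
      continuous_toFun := (rotMap a).continuous
      continuous_invFun := (rotMap (-a)).continuous })
  all_goals simp [rot_rot, rot_zero]

theorem integral_monomial (k : ℤ) : ∫ z, monomial k z ∂lebesgue = if k = 0 then 1 else 0 := by
  split_ifs with hk
  · simp [hk, monomial_zero]
  -- Any irrational rotation serves here; `√2` is an arbitrary choice unrelated to `θ`.
  · have h := integral_comp_rot (√2) (monomial k)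
    have h' : ∀ z, monomial k (rot √2 z) = _ := fun z =>
      DFunLike.congr_fun (monomial_comp_rotMap k √2) z
    simp only [h', ContinuousMap.smul_apply, smul_eq_mul, integral_const_mul] at h
    by_contra h0
    exact exp_zpow_ne_one irrational_sqrt_two hk (mul_right_cancel₀ h0 (by rw [h, one_mul]))

/-- Integration of continuous functions against Lebesgue measure. -/
def integralCLM : C(Circle, ℂ) →L[ℂ] ℂ :=
  LinearMap.mkContinuous
    { toFun := fun h => ∫ z, h z ∂lebesgue
      map_add' := fun h k => integral_add
        (h.continuous.integrable_of_hasCompactSupport (HasCompactSupport.of_compactSpace _))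
        (k.continuous.integrable_of_hasCompactSupport (HasCompactSupport.of_compactSpace _))
      map_smul' := fun c h => integral_const_mul c _ } 1 fun h => by
    simpa using norm_integral_le_of_norm_le_const (μ := lebesgue)
      (Filter.Eventually.of_forall fun z => h.norm_coe_le_norm z)

theorem integralCLM_apply (h : C(Circle, ℂ)) : integralCLM h = ∫ z, h z ∂lebesgue := rfl

end Circle

/-! ### Homomorphisms and the functional calculus on powers of unitaries. -/

theorem StarAlgHom.continuous_of_cstar {A B : Type*} [CStarAlgebra A] [CStarAlgebra B]
    (φ : A →⋆ₐ[ℂ] B) : Continuous φ :=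
  (AddMonoidHomClass.lipschitz_of_bound φ 1 fun x => by
    simpa using NonUnitalStarAlgHom.norm_apply_le φ x).continuous

/-- A `*`-homomorphism of `C^*`-algebras as a continuous linear map. -/
def StarAlgHom.toCLM {A B : Type*} [CStarAlgebra A] [CStarAlgebra B] (φ : A →⋆ₐ[ℂ] B) :
    A →L[ℂ] B :=
  ⟨φ.toAlgHom.toLinearMap, φ.continuous_of_cstar⟩

theorem StarAlgHom.map_unitary_zpow {A B : Type*} [CStarAlgebra A] [CStarAlgebra B]
    (φ : A →⋆ₐ[ℂ] B) {a : unitary A} {b : unitary B} (h : φ a = b) (k : ℤ) :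
    φ ((a ^ k : unitary A) : A) = ((b ^ k : unitary B) : B) := by
  have h' : Unitary.map
      ({ toFun := φ
         map_one' := map_one _
         map_mul' := map_mul _
         map_star' := map_star _ } : A →⋆* B) a = b := Subtype.ext h
  rw [← h', ← map_zpow]
  rfl

section Calculus

variable {A : Type*} [CStarAlgebra A]

/-- The functional calculus sends `z ↦ z ^ k` to `u ^ k`. -/
theorem circleCalculus_monomial (u : unitary A) (k : ℤ) :
    circleCalculus u (Circle.monomial k) = ((u ^ k : unitary A) : A) := by
  let W : Multiplicative ℤ →* unitary C(Circle, ℂ) :=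
    { toFun := fun k => ⟨Circle.monomial k.toAdd, by
        rw [Unitary.mem_iff, Circle.star_monomial, ← Circle.monomial_add, ← Circle.monomial_add]
        simp [Circle.monomial_zero]⟩
      map_one' := Subtype.ext Circle.monomial_zero
      map_mul' := fun k l => Subtype.ext (Circle.monomial_add k.toAdd l.toAdd) }
  have hw : circleCalculus u (W (Multiplicative.ofAdd 1) : C(Circle, ℂ)) = u := by
    conv_rhs => rw [← circleCalculus_coe u]
    congr 1
    ext z
    simp [W, Circle.monomial_apply]
  rw [← StarAlgHom.map_unitary_zpow _ hw, ← map_zpow, ← ofAdd_zsmul, zsmul_one]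
  rfl

theorem rotateUnitary_zpow (c : Circle) (u : unitary A) (k : ℤ) :
    rotateUnitary c u ^ k = rotateUnitary (c ^ k) (u ^ k) := by
  let W : Circle × unitary A →* unitary A :=
    { toFun := fun p => rotateUnitary p.1 p.2
      map_one' := Subtype.ext (one_smul ℂ (1 : A))
      map_mul' := fun p q => Subtype.ext (smul_mul_smul_comm (p.1 : ℂ) (p.2 : A) (q.1 : ℂ)
        (q.2 : A)).symm }
  exact (map_zpow W (c, u) k).symm

end Calculus

/-! ### The spanning elements `h(U) V^l` and their multiplication rules. -/

namespace NCTorus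

variable {α : ℝ}

variable (α) in
/-- The element `h (U) V ^ l` of `𝔸_α`. -/
def term (h : C(Circle, ℂ)) (l : ℤ) : NCTorus α :=
  circleCalculus (U α) h * ((V α ^ l : unitary (NCTorus α)) : NCTorus α)

variable (α) in
/-- The element `h (U) V ^ l` as a function of `h`. -/
def termCLM (l : ℤ) : C(Circle, ℂ) →L[ℂ] NCTorus α :=
  (ContinuousLinearMap.mul ℂ (NCTorus α)).flip ((V α ^ l : unitary (NCTorus α)) : NCTorus α) ∘L
    (circleCalculus (U α)).toCLM

theorem termCLM_apply (h : C(Circle, ℂ)) (l : ℤ) : termCLM α l h = term α h l := rfl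

/-- Since `V U V⁻¹ = e^{-2πiα} U`, conjugation by `V` rotates the functional calculus of `U`. By
density it is enough to see this on powers of `U`. -/
theorem V_mul_circleCalculus (h : C(Circle, ℂ)) :
    (V α : NCTorus α) * circleCalculus (U α) h =
      circleCalculus (U α) (h.comp (Circle.rotMap (-α))) * V α := by
  have hVU : V α * U α * (V α)⁻¹ = rotateUnitary (Circle.exp (2 * Real.pi * -α)) (U α) := by
    rw [mul_inv_eq_iff_eq_mul]
    ext
    change (V α : NCTorus α) * U α =
      ((Circle.exp (2 * Real.pi * -α) : Circle) : ℂ) • (U α : NCTorus α) * (V α : NCTorus α)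
    rw [smul_mul_assoc, U_mul_V, smul_smul, Circle.coe_exp, ← Complex.exp_add]
    convert (one_smul ℂ _).symm using 2
    rw [← Complex.exp_zero]
    congr 1
    push_cast; ring
  have hk : ∀ k : ℤ, (V α : NCTorus α) * ((U α ^ k : unitary (NCTorus α)) : NCTorus α) =
      ((Circle.exp (2 * Real.pi * -α) ^ k : Circle) : ℂ) •
        ((U α ^ k : unitary (NCTorus α)) : NCTorus α) * (V α : NCTorus α) := by
    intro k
    have := congrArg (· ^ k) hVU
    simp only [conj_zpow, rotateUnitary_zpow, mul_inv_eq_iff_eq_mul] at this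
    exact congrArg Subtype.val this
  have key : ContinuousLinearMap.mul ℂ (NCTorus α) (V α : NCTorus α) ∘L
      (circleCalculus (U α)).toCLM =
      (ContinuousLinearMap.mul ℂ (NCTorus α)).flip (V α : NCTorus α) ∘L
        (circleCalculus (U α)).toCLM ∘L Circle.compCLM (Circle.rotMap (-α)) := by
    refine Circle.clm_ext fun k => ?_
    change (V α : NCTorus α) * circleCalculus (U α) (Circle.monomial k) =
      circleCalculus (U α) ((Circle.monomial k).comp (Circle.rotMap (-α))) * (V α : NCTorus α)
    rw [Circle.monomial_comp_rotMap, map_smul, circleCalculus_monomial, hk]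
  exact DFunLike.congr_fun key h

theorem V_zpow_mul_circleCalculus (l : ℤ) (h : C(Circle, ℂ)) :
    ((V α ^ l : unitary (NCTorus α)) : NCTorus α) * circleCalculus (U α) h =
      circleCalculus (U α) (h.comp (Circle.rotMap (-(l * α)))) *
        ((V α ^ l : unitary (NCTorus α)) : NCTorus α) := by
  -- The inverse rule, needed for the downward induction, comes from the rule for `V` applied to `h
  -- ∘ R_α`.
  have key : ∀ h, ((V α)⁻¹ : unitary (NCTorus α)) * circleCalculus (U α) h =
      circleCalculus (U α) (h.comp (Circle.rotMap α)) *
        ((V α)⁻¹ : unitary (NCTorus α)) := by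
    intro h
    have := V_mul_circleCalculus (α := α) (h.comp (Circle.rotMap α))
    have e : (h.comp (Circle.rotMap α)).comp (Circle.rotMap (-α)) = h := by
      ext z; simp [Circle.rotMap_apply, Circle.rot_rot, Circle.rot_zero]
    rw [e] at this
    have h1 : ((V α)⁻¹ : unitary (NCTorus α)) * (V α : NCTorus α) = 1 := by
      rw [← Submonoid.coe_mul, inv_mul_cancel]; rfl
    have h2 : (V α : NCTorus α) * ((V α)⁻¹ : unitary (NCTorus α)) = 1 := by
      rw [← Submonoid.coe_mul, mul_inv_cancel]; rfl
    calc _ = (((V α)⁻¹ : unitary (NCTorus α)) : NCTorus α) * (circleCalculus (U α) h * V α) *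
          ((V α)⁻¹ : unitary (NCTorus α)) := by simp only [mul_assoc, h2, mul_one]
      _ = _ := by rw [← this, ← mul_assoc, h1, one_mul]
  induction l using Int.induction_on generalizing h with
  | zero =>
    have e : h.comp (Circle.rotMap 0) = h := by
      ext z; simp [Circle.rotMap_apply, Circle.rot_zero]
    simp [e]
  | succ k ih =>
    rw [zpow_add_one, Submonoid.coe_mul, mul_assoc, V_mul_circleCalculus, ← mul_assoc, ih,
      mul_assoc]
    congr 2
    ext z
    simp only [ContinuousMap.comp_apply, Circle.rotMap_apply, Circle.rot_rot]
    congr 2; push_cast; ring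
  | pred k ih =>
    rw [zpow_sub_one, Submonoid.coe_mul, mul_assoc, key, ← mul_assoc, ih, mul_assoc]
    congr 2
    ext z
    simp only [ContinuousMap.comp_apply, Circle.rotMap_apply, Circle.rot_rot]
    congr 2; push_cast; ring

theorem term_mul_term (h k : C(Circle, ℂ)) (l m : ℤ) :
    term α h l * term α k m =
      term α (h * k.comp (Circle.rotMap (-(l * α)))) (l + m) := by
  rw [term, term, term, map_mul, zpow_add, Submonoid.coe_mul, mul_assoc, ← mul_assoc _ _
    ((V α ^ m : unitary (NCTorus α)) : NCTorus α), V_zpow_mul_circleCalculus]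
  simp only [mul_assoc]

theorem term_zero (h : C(Circle, ℂ)) : term α h 0 = circleCalculus (U α) h := by simp [term]

theorem term_one_left (l : ℤ) :
    term α 1 l = ((V α ^ l : unitary (NCTorus α)) : NCTorus α) := by simp [term]

theorem term_one_zero : term α 1 0 = 1 := by simp [term]

theorem star_term (h : C(Circle, ℂ)) (l : ℤ) :
    star (term α h l) = term α ((star h).comp (Circle.rotMap (l * α))) (-l) := by
  rw [term, star_mul, ← map_star, ← Unitary.coe_star, Unitary.star_eq_inv, ← zpow_neg,
    V_zpow_mul_circleCalculus, term]
  congr 4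
  push_cast; ring

/-- The set of all `h(U) V^l` contains the generators and is closed under products and adjoints, so
every word in `U`, `V` is a single such element; this yields density of their span. -/
theorem exists_mk_mono_eq_term (g : FreeGroup Bool) :
    ∃ h l, mk (PreTorus.mono α g 1) = term α h l := by
  induction g using FreeGroup.induction_on with
  | C1 => exact ⟨1, 0, term_one_zero.symm⟩
  | of i =>
    cases i
    · exact ⟨1, 1, by rw [term_one_left, zpow_one]; rfl⟩
    · exact ⟨Circle.monomial 1, 0, by
        rw [term_zero, circleCalculus_monomial, zpow_one]; rfl⟩
  | inv_of i hi =>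
    obtain ⟨h, l, hl⟩ := hi
    refine ⟨_, _, Eq.trans ?_ (star_term h l)⟩
    rw [← hl, star_mk, PreTorus.star_mono, star_one]
  | mul g h hg hh =>
    obtain ⟨p, l, hl⟩ := hg
    obtain ⟨q, m, hm⟩ := hh
    refine ⟨_, _, Eq.trans ?_ (term_mul_term p q l m)⟩
    rw [← hl, ← hm, ← mk_mul, PreTorus.mono_mul_mono, mul_one]

/-- Continuous linear maps on `𝔸_α` that agree on all `h (U) V ^ l` are equal. -/
theorem clm_ext_term {E : Type*} [NormedAddCommGroup E] [NormedSpace ℂ E]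
    {F G : NCTorus α →L[ℂ] E} (hFG : ∀ h l, F (term α h l) = G (term α h l)) : F = G := by
  ext x
  induction x using induction with
  | hc => exact isClosed_eq F.continuous G.continuous
  | h x =>
    induction x using PreTorus.induction with
    | zero =>
      have : mk (0 : PreTorus α) = 0 := by rw [← zero_smul ℂ (0 : PreTorus α), mk_smul, zero_smul]
      rw [this, map_zero, map_zero]
    | add x y hx hy => rw [mk_add, map_add, map_add, hx, hy]
    | mono g c =>
      have : PreTorus.mono α g c = c • PreTorus.mono α g 1 := by rw [PreTorus.smul_mono, mul_one]
      obtain ⟨h, l, hl⟩ := exists_mk_mono_eq_term (α := α) g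
      rw [this, mk_smul, map_smul, map_smul, hl, hFG]

/-- `τ (h (U) V ^ l) = δ_{l, 0} ∫ h`. -/
theorem trace_term (h : C(Circle, ℂ)) (l : ℤ) :
    trace α (term α h l) = if l = 0 then ∫ z, h z ∂Circle.lebesgue else 0 := by
  have : trace α ∘L termCLM α l = (if l = 0 then 1 else 0 : ℂ) • Circle.integralCLM := by
    refine Circle.clm_ext fun k => ?_
    rw [ContinuousLinearMap.comp_apply, termCLM_apply, term, circleCalculus_monomial,
      trace_U_zpow_mul_V_zpow, smul_apply, Circle.integralCLM_apply,
      Circle.integral_monomial]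
    by_cases hk : k = 0 <;> by_cases hl : l = 0 <;> simp [hk, hl]
  have h2 := DFunLike.congr_fun this h
  rw [ContinuousLinearMap.comp_apply, termCLM_apply] at h2
  rw [h2, smul_apply, Circle.integralCLM_apply]
  split_ifs <;> simp

/-- On powers of `U` the skew-product is multiplication by `e^{ikθ}`, which is what rotation by
`θ/2π` does to monomials; density gives the rest. -/
theorem anzai_circleCalculus (θ : ℝ) (f : C(Circle, Circle)) (h : C(Circle, ℂ)) :
    anzai α θ f (circleCalculus (U α) h) =
      circleCalculus (U α) (h.comp (Circle.rotMap (θ / (2 * Real.pi)))) := by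
  have key : (anzai α θ f).toCLM ∘L (circleCalculus (U α)).toCLM =
      (circleCalculus (U α)).toCLM ∘L
        Circle.compCLM (Circle.rotMap (θ / (2 * Real.pi))) := by
    refine Circle.clm_ext fun k => ?_
    change anzai α θ f (circleCalculus (U α) (Circle.monomial k)) =
      circleCalculus (U α) ((Circle.monomial k).comp (Circle.rotMap (θ / (2 * Real.pi))))
    rw [Circle.monomial_comp_rotMap, map_smul, circleCalculus_monomial, anzai,
      StarAlgHom.map_unitary_zpow _ (lift_U _ _ _), rotateUnitary_zpow,
      mul_div_cancel₀ _ Real.two_pi_pos.ne']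
    rfl
  exact DFunLike.congr_fun key h

end NCTorus

/-! ### The cocycle and the action of the skew-product on each fibre. -/

/-- The cocycle `f_n` as a continuous function. -/
def cocycleMap (α : ℝ) (f : C(Circle, Circle)) (n : ℤ) : C(Circle, ℂ) :=
  ⟨cocycle α f n, by
    cases n with
    | ofNat n =>
      exact continuous_finsetProd _ fun l _ => continuous_circle_coe.comp
        (f.continuous.comp (Circle.rotMap _).continuous)
    | negSucc n =>
      exact continuous_finsetProd _ fun l _ => Complex.continuous_conj.comp
        (continuous_circle_coe.comp (f.continuous.comp (Circle.rotMap _).continuous))⟩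

theorem cocycleMap_apply (α : ℝ) (f : C(Circle, Circle)) (n : ℤ) (z : Circle) :
    cocycleMap α f n z = cocycle α f n z := rfl

theorem norm_cocycle (α : ℝ) (f : C(Circle, Circle)) (n : ℤ) (z : Circle) :
    ‖cocycle α f n z‖ = 1 := by
  cases n <;> simp [cocycle, norm_prod, Circle.norm_coe]

theorem cocycleMap_zero (α : ℝ) (f : C(Circle, Circle)) : cocycleMap α f 0 = 1 := by
  ext z
  rfl

theorem prod_Icc_one_eq_prod_range {M : Type*} [CommMonoid M] (F : ℕ → M) (n : ℕ) :
    ∏ l ∈ Finset.Icc 1 n, F l = ∏ l ∈ Finset.range n, F (l + 1) := by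
  rw [Finset.range_eq_Ico, Finset.prod_Ico_add' F 0 n 1]
  rfl

/-- The recursion matching left multiplication by `f(U) V`. For `n ≥ 0` it splits off the factor `l
= 0`; for `n < 0` the new factor `f z` cancels the conjugate factor `l = 1`, because `|f| = 1`. -/
theorem cocycle_add_one (α : ℝ) (f : C(Circle, Circle)) (n : ℤ) (z : Circle) :
    cocycle α f (n + 1) z = f z * cocycle α f n (Circle.rot (-α) z) := by
  cases n with
  | ofNat n =>
    change ∏ l ∈ Finset.range (n + 1), (f (Circle.rot (-(l * α)) z) : ℂ) =
      _ * ∏ l ∈ Finset.range n, (f (Circle.rot (-(l * α)) (Circle.rot (-α) z)) : ℂ)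
    rw [Finset.prod_range_succ', mul_comm]
    congr 1
    · simp [Circle.rot_zero]
    · refine Finset.prod_congr rfl fun l _ => ?_
      rw [Circle.rot_rot]
      congr 3; push_cast; ring
  | negSucc n =>
    have h0 : (f z : ℂ) * starRingEnd ℂ (f z : ℂ) = 1 := by
      simp [← Circle.coe_inv_eq_conj]
    have h1 : cocycle α f (Int.negSucc n) (Circle.rot (-α) z) =
        (∏ l ∈ Finset.range n, starRingEnd ℂ (f (Circle.rot ((l + 1 : ℕ) * α) z) : ℂ)) *
          starRingEnd ℂ (f z : ℂ) := by
      change ∏ l ∈ Finset.Icc 1 (n + 1),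
        starRingEnd ℂ (f (Circle.rot (l * α) (Circle.rot (-α) z)) : ℂ) = _
      rw [prod_Icc_one_eq_prod_range, Finset.prod_range_succ']
      congr 1
      · refine Finset.prod_congr rfl fun l _ => ?_
        rw [Circle.rot_rot]
        congr 4; push_cast; ring
      · simp [Circle.rot_rot, Circle.rot_zero]
    rw [h1, mul_comm (Finset.prod _ _), ← mul_assoc, h0, one_mul]
    -- Here `-(n+1) + 1 = -n` falls in the nonnegative branch of `cocycle` exactly when `n = 0`.
    cases n with
    | zero => rfl
    | succ n =>
      change ∏ l ∈ Finset.Icc 1 (n + 1), starRingEnd ℂ (f (Circle.rot (l * α) z) : ℂ) = _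
      rw [prod_Icc_one_eq_prod_range]

namespace NCTorus

variable {α : ℝ}

/-- `(f (U) V) ^ n = f_n (U) V ^ n`. -/
theorem circleApply_mul_V_zpow (f : C(Circle, Circle)) (n : ℤ) :
    (((circleApply f (U α) * V α) ^ n : unitary (NCTorus α)) : NCTorus α) =
      term α (cocycleMap α f n) n := by
  let fc : C(Circle, ℂ) := ⟨fun z => (f z : ℂ), continuous_circle_coe.comp f.continuous⟩
  have hf : ((circleApply f (U α) * V α : unitary (NCTorus α)) : NCTorus α) = term α fc 1 := by
    rw [term, zpow_one]; rfl
  have step : ∀ n : ℤ, term α fc 1 * term α (cocycleMap α f n) n =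
      term α (cocycleMap α f (n + 1)) (n + 1) := by
    intro n
    rw [term_mul_term, add_comm 1 n]
    congr 1
    ext z
    simp only [ContinuousMap.mul_apply, ContinuousMap.comp_apply, cocycleMap_apply,
      cocycle_add_one, Circle.rotMap_apply, Int.cast_one, one_mul]
    rfl
  induction n using Int.induction_on with
  | zero => rw [zpow_zero, cocycleMap_zero, term_one_zero]; rfl
  | succ k ih => rw [add_comm, zpow_one_add, Submonoid.coe_mul, ih, hf, step, add_comm]
  | pred k ih =>
    -- Going down, the recursion at `-k - 1` is solved for its second factor by cancelling the
    -- unitary `w`.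
    have h := step (-k - 1)
    rw [sub_add_cancel, ← ih, ← hf] at h
    generalize (circleApply f (U α) * V α) = w at *
    have : (w : NCTorus α) * ((w ^ (-(k : ℤ) - 1) : unitary (NCTorus α)) : NCTorus α) =
        ((w ^ (-(k : ℤ)) : unitary (NCTorus α)) : NCTorus α) := by
      rw [← Submonoid.coe_mul, ← zpow_one_add]; congr 2; ring
    rw [← this] at h
    have hw : ((w⁻¹ : unitary (NCTorus α)) : NCTorus α) * w = 1 := by
      rw [← Submonoid.coe_mul, inv_mul_cancel]; rfl
    have := congrArg (fun x => ((w⁻¹ : unitary (NCTorus α)) : NCTorus α) * x) h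
    simpa only [← mul_assoc, hw, one_mul] using this.symm

/-- The link between the dynamics and the cohomological equation: fibres are preserved, and on the
`l`-th one the action is a rotation weighted by `f_l`. -/
theorem anzai_term (θ : ℝ) (f : C(Circle, Circle)) (h : C(Circle, ℂ)) (l : ℤ) :
    anzai α θ f (term α h l) =
      term α (h.comp (Circle.rotMap (θ / (2 * Real.pi))) * cocycleMap α f l) l := by
  rw [term, map_mul, anzai_circleCalculus, StarAlgHom.map_unitary_zpow (anzai α θ f) (lift_V _ _ _),
    circleApply_mul_V_zpow, ← term_zero, term_mul_term, zero_add]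
  congr 2
  ext z
  simp [Circle.rotMap_apply, Circle.rot_zero]

end NCTorus

/-! ### Hermitian symmetry and Cauchy–Schwarz for states. -/

section States

variable {A : Type*} [CStarAlgebra A]

theorem states.apply_star {φ : A →L[ℂ] ℂ} (hφ : φ ∈ states A) (a : A) :
    φ (star a) = conj (φ a) := by
  -- The number `φ((a + c)^*(a + c))` is real for every scalar `c`; the cases `c = 1` and `c = i`
  -- determine the imaginary and real parts.
  have key : ∀ c : ℂ, (c * φ (star a) + conj c * φ a).im = 0 := by
    intro c
    have h1 := (Complex.nonneg_iff.1 (hφ.2 (a + c • 1))).2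
    have h2 := (Complex.nonneg_iff.1 (hφ.2 a)).2
    have h3 : star (a + c • 1) * (a + c • 1) =
        star a * a + c • star a + conj c • a + (conj c * c) • 1 := by
      simp only [star_add, star_smul, star_one, add_mul, mul_add, smul_mul_assoc, mul_smul_comm,
        one_mul, mul_one, Complex.star_def, smul_add, mul_smul, mul_comm (conj c) c]
      abel
    rw [h3] at h1
    simp only [map_add, map_smul, hφ.1, smul_eq_mul, mul_one] at h1
    have h4 : (conj c * c).im = 0 := by rw [← Complex.normSq_eq_conj_mul_self]; simp
    simp only [Complex.add_im] at h1 ⊢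
    linarith
  have h1 := key 1
  have h2 := key Complex.I
  simp at h1 h2
  apply Complex.ext <;> simp <;> linarith

/-- The Cauchy–Schwarz inequality for states. -/
theorem states.norm_sq_le {φ : A →L[ℂ] ℂ} (hφ : φ ∈ states A) (a b : A) :
    ‖φ (star a * b)‖ ^ 2 ≤ (φ (star a * a)).re * (φ (star b * b)).re := by
  let _ : PreInnerProductSpace.Core ℂ A :=
    { inner := fun x y => φ (star x * y)
      conj_inner_symm := fun x y => by rw [← states.apply_star hφ, star_mul, star_star]
      re_inner_nonneg := fun x => (Complex.nonneg_iff.1 (hφ.2 x)).1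
      add_left := fun x y z => by simp [add_mul]
      smul_left := fun x y r => by simp }
  have h := InnerProductSpace.Core.inner_mul_inner_self_le (𝕜 := ℂ) a b
  have h2 : φ (star b * a) = conj (φ (star a * b)) := by
    rw [← states.apply_star hφ, star_mul, star_star]
  change ‖φ (star a * b)‖ * ‖φ (star b * a)‖ ≤ _ at h
  rw [h2, RCLike.norm_conj, ← sq] at h
  exact h

end States

/-! ### Square-integrable functions on the circle -/

namespace Circle

/-- The class in `L²(𝕋)` of a continuous function. -/
def toL2 : C(Circle, ℂ) →L[ℂ] Lp ℂ 2 lebesgue := ContinuousMap.toLp 2 lebesgue ℂ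

theorem denseRange_toL2 : DenseRange toL2 :=
  ContinuousMap.toLp_denseRange ℂ lebesgue ℂ (by norm_num)

theorem inner_toL2 (g : Lp ℂ 2 lebesgue) (h : C(Circle, ℂ)) :
    inner ℂ g (toL2 h) = ∫ z, conj (g z) * h z ∂lebesgue := by
  rw [L2.inner_def]
  refine integral_congr_ae ?_
  filter_upwards [ContinuousMap.coeFn_toLp (p := 2) (𝕜 := ℂ) lebesgue h] with z hz
  rw [RCLike.inner_apply, mul_comm, toL2, hz]

theorem inner_toL2_toL2 (g h : C(Circle, ℂ)) :
    inner ℂ (toL2 g) (toL2 h) = ∫ z, conj (g z) * h z ∂lebesgue := by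
  rw [inner_toL2]
  refine integral_congr_ae ?_
  filter_upwards [ContinuousMap.coeFn_toLp (p := 2) (𝕜 := ℂ) lebesgue g] with z hz
  rw [toL2, hz]

theorem memLp_mul (c : C(Circle, ℂ)) (g : Lp ℂ 2 lebesgue) :
    MemLp (fun z => c z * g z) 2 lebesgue :=
  (Lp.memLp g).mul' (memLp_top_of_bound c.continuous.aestronglyMeasurable ‖c‖
    (Filter.Eventually.of_forall c.norm_coe_le_norm))

/-- The product of a continuous and a square-integrable function. -/
def mulL2 (c : C(Circle, ℂ)) (g : Lp ℂ 2 lebesgue) : Lp ℂ 2 lebesgue := (memLp_mul c g).toLp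

theorem coeFn_mulL2 (c : C(Circle, ℂ)) (g : Lp ℂ 2 lebesgue) :
    mulL2 c g =ᵐ[lebesgue] fun z => c z * g z := MemLp.coeFn_toLp _

theorem inner_toL2_mul (g : Lp ℂ 2 lebesgue) (c h : C(Circle, ℂ)) :
    inner ℂ g (toL2 (c * h)) = inner ℂ (mulL2 (star c) g) (toL2 h) := by
  rw [inner_toL2, inner_toL2]
  refine integral_congr_ae ?_
  filter_upwards [coeFn_mulL2 (star c) g] with z hz
  simp [hz]; ring

theorem inner_mulL2_star (c : C(Circle, ℂ)) (g : Lp ℂ 2 lebesgue) :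
    inner ℂ (mulL2 (star c) g) g = ∫ z, c z * ‖g z‖ ^ 2 ∂lebesgue := by
  rw [L2.inner_def]
  refine integral_congr_ae ?_
  filter_upwards [coeFn_mulL2 (star c) g] with z hz
  rw [hz, RCLike.inner_apply, ← Complex.conj_mul']
  simp; ring

/-- The composition of a square-integrable function with a rotation. -/
def rotL2 (a : ℝ) (g : Lp ℂ 2 lebesgue) : Lp ℂ 2 lebesgue :=
  Lp.compMeasurePreserving (rot a) (measurePreserving_rot a) g

theorem coeFn_rotL2 (a : ℝ) (g : Lp ℂ 2 lebesgue) :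
    rotL2 a g =ᵐ[lebesgue] fun z => g (rot a z) :=
  Lp.coeFn_compMeasurePreserving g (measurePreserving_rot a)

end Circle

/-- Since `|f_n| = 1` and rotations preserve the measure, `h ↦ (h ∘ R) f_n` is unitary on `L²`; a
vector is fixed by a unitary exactly when it is fixed by its adjoint. The weak form needs only
continuous `h`, where states can be evaluated. -/
theorem solvesCohomological_iff {α θ : ℝ} {f : C(Circle, Circle)} {n : ℤ}
    {g : Lp ℂ 2 Circle.lebesgue} :
    SolvesCohomological α θ f n g ↔
      ∀ h : C(Circle, ℂ), inner ℂ g (Circle.toL2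
        (h.comp (Circle.rotMap (θ / (2 * Real.pi))) * cocycleMap α f n)) =
          inner ℂ g (Circle.toL2 h) := by
  set a := θ / (2 * Real.pi) with ha
  have hmul : ∀ z, conj (cocycle α f n z) * cocycle α f n z = 1 := fun z => by
    rw [Complex.conj_mul', norm_cocycle]; simp
  constructor
  · intro hg h
    rw [Circle.inner_toL2, Circle.inner_toL2,
      ← Circle.integral_comp_rot a fun z => conj (g z) * h z]
    refine integral_congr_ae ?_
    filter_upwards [hg] with z hz
    rw [← hz, map_mul]
    change _ * (h (Circle.rot a z) * cocycle α f n z) = _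
    linear_combination (conj (g (Circle.rot a z)) * h (Circle.rot a z)) * hmul z
  · intro hg
    have key : Circle.mulL2 (cocycleMap α f n) (Circle.rotL2 a g) = g := by
      refine Circle.denseRange_toL2.eq_of_inner_left ℂ fun h => ?_
      -- This is the preimage of `h` under the weighted rotation.
      let k : C(Circle, ℂ) := (h * star (cocycleMap α f n)).comp (Circle.rotMap (-a))
      have hk : ∀ z, k (Circle.rot a z) = h z * conj (cocycle α f n z) := fun z => by
        simp [k, Circle.rotMap_apply, Circle.rot_rot, Circle.rot_zero, cocycleMap_apply]
      have hk' : k.comp (Circle.rotMap a) * cocycleMap α f n = h := by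
        ext z
        change k (Circle.rot a z) * cocycle α f n z = h z
        rw [hk, mul_assoc, hmul, mul_one]
      have := hg k
      rw [hk'] at this
      rw [this, Circle.inner_toL2, Circle.inner_toL2,
        ← Circle.integral_comp_rot a fun z => conj (g z) * k z]
      refine integral_congr_ae ?_
      filter_upwards [Circle.coeFn_mulL2 (cocycleMap α f n) (Circle.rotL2 a g),
        Circle.coeFn_rotL2 a g] with z h1 h2
      rw [h1, h2, hk, map_mul, cocycleMap_apply]
      ring
    have h0 := Circle.coeFn_mulL2 (cocycleMap α f n) (Circle.rotL2 a g)
    rw [key] at h0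
    refine Filter.EventuallyEq.symm ?_
    filter_upwards [h0, Circle.coeFn_rotL2 a g] with z h1 h2
    rw [h1, h2, cocycleMap_apply, mul_comm]

/-- `|g|²` is constant for a solution `g` of a cohomological equation: its nontrivial Fourier
coefficients vanish. -/
theorem SolvesCohomological.integral_monomial_mul {α θ : ℝ} (hθ : Irrational (θ / (2 * Real.pi)))
    {f : C(Circle, Circle)} {n : ℤ} {g : Lp ℂ 2 Circle.lebesgue}
    (hg : SolvesCohomological α θ f n g) {k : ℤ} (hk : k ≠ 0) :
    ∫ z, Circle.monomial k z * ‖g z‖ ^ 2 ∂Circle.lebesgue = 0 := by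
  -- The modulus of the equation reads `|g ∘ R| = |g|`, so the change of variables only multiplies
  -- the coefficient by the `k`-th power of `e^{iθ}`.
  have h := Circle.integral_comp_rot (θ / (2 * Real.pi))
    fun z => Circle.monomial k z * (‖g z‖ : ℂ) ^ 2
  have h' : ∫ z, Circle.monomial k (Circle.rot (θ / (2 * Real.pi)) z) *
      (‖g (Circle.rot (θ / (2 * Real.pi)) z)‖ : ℂ) ^ 2 ∂Circle.lebesgue =
      ((Circle.exp (2 * Real.pi * (θ / (2 * Real.pi))) ^ k : Circle) : ℂ) *
        ∫ z, Circle.monomial k z * ‖g z‖ ^ 2 ∂Circle.lebesgue := by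
    rw [← integral_const_mul]
    refine integral_congr_ae ?_
    filter_upwards [hg] with z hz
    have := DFunLike.congr_fun (Circle.monomial_comp_rotMap k (θ / (2 * Real.pi))) z
    change Circle.monomial k (Circle.rot (θ / (2 * Real.pi)) z) = _ * _ at this
    rw [this, ← hz, norm_mul, norm_cocycle, mul_one, mul_assoc]
  rw [h'] at h
  by_contra h0
  exact Circle.exp_zpow_ne_one hθ hk (mul_right_cancel₀ h0 (by rw [h, one_mul]))

/-! ### Matrix coefficients of the regular representation and invariance of the trace. -/

namespace NCTorus

variable {α : ℝ}

theorem star_term_mul_term (h k : C(Circle, ℂ)) (l m : ℤ) :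
    star (term α h l) * term α k m =
      term α ((star h * k).comp (Circle.rotMap (l * α))) (m - l) := by
  rw [star_term, term_mul_term]
  congr 1
  · ext z
    simp [Circle.rotMap_apply]
  · ring

/-- Distinct fibres are orthogonal for the trace, and each carries the `L²` inner product: the
rotation caused by moving `V^{-l}` across is absorbed by the measure. -/
theorem trace_star_term_mul_term (h k : C(Circle, ℂ)) (l m : ℤ) :
    trace α (star (term α h l) * term α k m) =
      if m = l then inner ℂ (Circle.toL2 h) (Circle.toL2 k) else 0 := by
  rw [star_term_mul_term, trace_term, Circle.inner_toL2_toL2,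
    ← Circle.integral_comp_rot (l * α) fun z => conj (h z) * k z]
  simp only [sub_eq_zero]
  rfl

/-- The matrix coefficients `a ↦ ⟨x, π (a) y⟩` of the regular representation. -/
def coeff (x y : EllTwo) : NCTorus α →L[ℂ] ℂ :=
  innerSL ℂ x ∘L (ContinuousLinearMap.apply ℂ EllTwo y) ∘L (regularRep α).toCLM

theorem coeff_apply (x y : EllTwo) (a : NCTorus α) :
    coeff x y a = inner ℂ x (regularRep α a y) := rfl

/-- The cyclic vector of the regular representation. -/
def vacuum : EllTwo := lp.single 2 (0, 0) 1

theorem trace_eq_coeff : trace α = coeff vacuum vacuum := rfl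

theorem inner_regularRep (a : NCTorus α) (x y : EllTwo) :
    inner ℂ (regularRep α a x) y = inner ℂ x (regularRep α (star a) y) := by
  rw [map_star, ContinuousLinearMap.star_eq_adjoint, ContinuousLinearMap.adjoint_inner_right]

theorem coeff_star_mul (x y : EllTwo) (a b : NCTorus α) :
    coeff x y (star a * b) = inner ℂ (regularRep α a x) (regularRep α b y) := by
  rw [coeff_apply, map_mul, inner_regularRep]; rfl

theorem coeff_self_nonneg (x : EllTwo) (a : NCTorus α) : 0 ≤ coeff x x (star a * a) := by
  rw [coeff_star_mul, inner_self_eq_norm_sq_to_K]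
  simp

theorem coeff_star (x y : EllTwo) (a : NCTorus α) : coeff x y (star a) = conj (coeff y x a) := by
  rw [coeff_apply, ← inner_regularRep, coeff_apply, inner_conj_symm]

theorem trace_mem_states : trace α ∈ states (NCTorus α) :=
  ⟨by rw [← term_one_zero, trace_term]; simp, fun a => by
    rw [trace_eq_coeff]; exact coeff_self_nonneg _ _⟩

/-- The trace sees only the fibre `l = 0`, where `f_0 = 1` and the action is a measure-preserving
rotation. -/
theorem trace_mem_invariantStates (θ : ℝ) (f : C(Circle, Circle)) :
    trace α ∈ invariantStates (anzai α θ f) := by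
  refine ⟨trace_mem_states, fun a => ?_⟩
  have : trace α ∘L (anzai α θ f).toCLM = trace α := by
    refine clm_ext_term fun h l => ?_
    change trace α (anzai α θ f (term α h l)) = _
    rw [anzai_term, trace_term, trace_term]
    split_ifs with hl
    · rw [hl, cocycleMap_zero, mul_one]
      exact Circle.integral_comp_rot _ h
    · rfl
  exact DFunLike.congr_fun this a

end NCTorus

namespace NCTorus

variable {α θ : ℝ} {f : C(Circle, Circle)}

/-! ### Unique ergodicity from the absence of solutions -/

theorem apply_term_zero_of_mem_invariantStates (hθ : Irrational (θ / (2 * Real.pi)))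
    {φ : NCTorus α →L[ℂ] ℂ} (hφ : φ ∈ invariantStates (anzai α θ f)) (h : C(Circle, ℂ)) :
    φ (term α h 0) = ∫ z, h z ∂Circle.lebesgue := by
  have key : φ ∘L termCLM α 0 = Circle.integralCLM := by
    refine Circle.clm_ext fun k => ?_
    rw [ContinuousLinearMap.comp_apply, termCLM_apply, Circle.integralCLM_apply,
      Circle.integral_monomial]
    split_ifs with hk
    · rw [hk, Circle.monomial_zero, term_one_zero, hφ.1.1]
    · have h1 := hφ.2 (term α (Circle.monomial k) 0)
      rw [anzai_term, cocycleMap_zero, mul_one, Circle.monomial_comp_rotMap, ← termCLM_apply,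
        map_smul, map_smul, smul_eq_mul] at h1
      by_contra h0
      exact Circle.exp_zpow_ne_one hθ hk (mul_right_cancel₀ h0 (by rw [one_mul]; exact h1))
  exact DFunLike.congr_fun key h

/-- An invariant state is, on each `{h (U) V ^ n}`, given by a square-integrable function. -/
theorem exists_apply_term_eq_inner (hθ : Irrational (θ / (2 * Real.pi)))
    {φ : NCTorus α →L[ℂ] ℂ} (hφ : φ ∈ invariantStates (anzai α θ f)) (n : ℤ) :
    ∃ g : Lp ℂ 2 Circle.lebesgue, ∀ h, φ (term α h n) = inner ℂ g (Circle.toL2 h) := by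
  have hb : ∀ h : C(Circle, ℂ), ‖φ (term α h n)‖ ≤ 1 * ‖Circle.toL2 h‖ := by
    intro h
    -- Writing `h(U) V^n` as the adjoint of the conjugate of `h` at `U`, times the unitary `V^n`,
    -- gives the constant `1`: the other factor is `∫ |h|²`.
    have h1 := states.norm_sq_le hφ.1 (term α (star h) 0) (term α 1 n)
    have e1 : star (term α (star h) 0) * term α 1 n = term α h n := by
      rw [star_term_mul_term]
      congr 1
      · ext z; simp [Circle.rotMap_apply, Circle.rot_zero]
      · ring
    have e2 : star (term α (star h) 0) * term α (star h) 0 = term α (star h * h) 0 := by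
      rw [star_term_mul_term]
      congr 1
      ext z; simp [Circle.rotMap_apply, Circle.rot_zero, mul_comm]
    have e3 : star (term α 1 n) * term α 1 n = (1 : NCTorus α) := by
      rw [star_term_mul_term, sub_self, ← term_one_zero]
      congr 1
      ext z; simp
    have e4 : φ (term α (star h * h) 0) = inner ℂ (Circle.toL2 h) (Circle.toL2 h) := by
      rw [apply_term_zero_of_mem_invariantStates hθ hφ, Circle.inner_toL2_toL2]
      rfl
    rw [e1, e2, e3, e4, hφ.1.1, Complex.one_re, mul_one] at h1
    have e5 : ‖Circle.toL2 h‖ ^ 2 = (inner ℂ (Circle.toL2 h) (Circle.toL2 h)).re :=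
      norm_sq_eq_re_inner (𝕜 := ℂ) _
    rw [← e5] at h1
    rw [one_mul]
    exact le_of_sq_le_sq h1 (norm_nonneg _)
  let F : C(Circle, ℂ) →ₗ[ℂ] ℂ := (φ ∘L termCLM α n).toLinearMap
  let e : C(Circle, ℂ) →ₗ[ℂ] Lp ℂ 2 Circle.lebesgue := Circle.toL2.toLinearMap
  -- The bound extends the functional from continuous functions to `L²`, where Riesz representation
  -- supplies `g`.
  refine ⟨(InnerProductSpace.toDual ℂ _).symm (F.extendOfNorm e), fun h => ?_⟩
  rw [InnerProductSpace.toDual_symm_apply]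
  exact (LinearMap.extendOfNorm_eq (f := F) (e := e) Circle.denseRange_toL2 ⟨1, hb⟩ h).symm

theorem isUniquelyErgodic_of_forall_not_solvesCohomological (hθ : Irrational (θ / (2 * Real.pi)))
    (H : ∀ n : ℤ, n ≠ 0 → ¬ ∃ g : Lp ℂ 2 Circle.lebesgue, g ≠ 0 ∧ SolvesCohomological α θ f n g) :
    IsUniquelyErgodic (anzai α θ f) := by
  refine ⟨trace α, trace_mem_invariantStates θ f, fun φ hφ => clm_ext_term fun h n => ?_⟩
  rw [trace_term]
  split_ifs with hn
  · rw [hn]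
    exact apply_term_zero_of_mem_invariantStates hθ hφ h
  · obtain ⟨g, hg⟩ := exists_apply_term_eq_inner hθ hφ n
    have hs : SolvesCohomological α θ f n g := solvesCohomological_iff.2 fun h => by
      rw [← hg, ← hg, ← anzai_term, hφ.2]
    have h0 : g = 0 := by
      by_contra h0
      exact H n hn ⟨g, h0, hs⟩
    rw [hg, h0, inner_zero_left]

theorem isErgodicState_trace_of_isUniquelyErgodic (H : IsUniquelyErgodic (anzai α θ f)) :
    IsErgodicState (anzai α θ f) (trace α) :=
  ⟨trace_mem_invariantStates θ f, fun _ h₁ _ _ _ =>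
    H.unique h₁ (trace_mem_invariantStates θ f)⟩

/-! ### A solution splits the trace -/

variable (α) in
/-- The extension to `L²(𝕋)` of the map `h ↦ π (h (U) V ^ n) δ_{0, 0}`. -/
def embed (n : ℤ) : Lp ℂ 2 Circle.lebesgue →L[ℂ] EllTwo :=
  ((ContinuousLinearMap.apply ℂ EllTwo vacuum) ∘L (regularRep α).toCLM ∘L
    termCLM α n).toLinearMap.extendOfNorm Circle.toL2.toLinearMap

theorem inner_regularRep_term (h k : C(Circle, ℂ)) (l m : ℤ) :
    inner ℂ (regularRep α (term α h l) vacuum) (regularRep α (term α k m) vacuum) =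
      if m = l then inner ℂ (Circle.toL2 h) (Circle.toL2 k) else 0 := by
  rw [← coeff_star_mul, ← trace_eq_coeff, trace_star_term_mul_term]

theorem embed_toL2 (n : ℤ) (h : C(Circle, ℂ)) :
    embed α n (Circle.toL2 h) = regularRep α (term α h n) vacuum := by
  refine LinearMap.extendOfNorm_eq Circle.denseRange_toL2 ⟨1, fun h => ?_⟩ h
  change ‖regularRep α (term α h n) vacuum‖ ≤ 1 * ‖Circle.toL2 h‖
  rw [one_mul, @norm_eq_sqrt_re_inner ℂ, @norm_eq_sqrt_re_inner ℂ _ _ _ _ (Circle.toL2 h),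
    inner_regularRep_term, if_pos rfl]

theorem inner_embed_term (n m : ℤ) (g : Lp ℂ 2 Circle.lebesgue) (h : C(Circle, ℂ)) :
    inner ℂ (embed α n g) (regularRep α (term α h m) vacuum) =
      if m = n then inner ℂ g (Circle.toL2 h) else 0 := by
  refine Circle.denseRange_toL2.induction_on g (isClosed_eq (by fun_prop) ?_) fun k => ?_
  · split_ifs <;> fun_prop
  · rw [embed_toL2, inner_regularRep_term]

/-- The element `h(U) V^m` moves the fibre `n` to the fibre `m + n`, which is orthogonal to the
vacuum unless the index is zero. -/
theorem coeff_vacuum_embed_term {n m : ℤ} (hnm : m + n ≠ 0) (g : Lp ℂ 2 Circle.lebesgue)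
    (h : C(Circle, ℂ)) : coeff vacuum (embed α n g) (term α h m) = 0 := by
  rw [coeff_apply]
  refine Circle.denseRange_toL2.induction_on g (isClosed_eq (by fun_prop) (by fun_prop))
    fun k => ?_
  rw [embed_toL2, ← mul_apply_eq_comp, ← map_mul, ← coeff_apply, ← trace_eq_coeff, term_mul_term,
    trace_term, if_neg hnm]

theorem coeff_embed_embed_term (n m : ℤ) (g : Lp ℂ 2 Circle.lebesgue) (h : C(Circle, ℂ)) :
    coeff (embed α n g) (embed α n g) (term α h m) =
      if m = 0 then ∫ z, h z * ‖g z‖ ^ 2 ∂Circle.lebesgue else 0 := by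
  -- The two slots are separated so that `g'` alone can be approximated by continuous functions.
  have key : ∀ g', coeff (embed α n g) (embed α n g') (term α h m) =
      if m = 0 then inner ℂ (Circle.mulL2 (star h) g) g' else 0 := by
    intro g'
    rw [coeff_apply]
    refine Circle.denseRange_toL2.induction_on g' (isClosed_eq (by fun_prop) ?_) fun k => ?_
    · split_ifs <;> fun_prop
    · rw [embed_toL2, ← mul_apply_eq_comp, ← map_mul, term_mul_term, inner_embed_term]
      simp only [add_eq_right]
      split_ifs with hm
      · rw [← Circle.inner_toL2_mul]
        congr 3
        ext z; simp [hm, Circle.rotMap_apply, Circle.rot_zero]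
      · rfl
  rw [key, Circle.inner_mulL2_star]

/-- The vector state of `embed α n g` integrates against `|g|²` on the fibre `0` and vanishes on the
others; for a unit solution that density has the Fourier coefficients of the constant `1`. -/
theorem coeff_embed_eq_trace (hθ : Irrational (θ / (2 * Real.pi))) {n : ℤ}
    {g : Lp ℂ 2 Circle.lebesgue} (hg : SolvesCohomological α θ f n g) (hn : ‖g‖ = 1) :
    coeff (embed α n g) (embed α n g) = trace α := by
  refine clm_ext_term fun h m => ?_
  by_cases hm : m = 0
  · subst hm
    have : coeff (embed α n g) (embed α n g) ∘L termCLM α 0 = trace α ∘L termCLM α 0 := by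
      refine Circle.clm_ext fun k => ?_
      simp only [ContinuousLinearMap.comp_apply, termCLM_apply]
      rw [coeff_embed_embed_term, trace_term, if_pos rfl, if_pos rfl, Circle.integral_monomial]
      split_ifs with hk
      · rw [hk, ← Circle.inner_mulL2_star, Circle.monomial_zero, star_one]
        have : Circle.mulL2 1 g = g := by
          refine Lp.ext ?_
          filter_upwards [Circle.coeFn_mulL2 1 g] with z hz
          simp [hz]
        rw [this, inner_self_eq_norm_sq_to_K, hn]
        simp
      · exact hg.integral_monomial_mul hθ hk
    exact DFunLike.congr_fun this h
  · rw [coeff_embed_embed_term, trace_term, if_neg hm, if_neg hm]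

theorem coeff_embed_vacuum_anzai {n : ℤ} {g : Lp ℂ 2 Circle.lebesgue}
    (hg : SolvesCohomological α θ f n g) (a : NCTorus α) :
    coeff (embed α n g) vacuum (anzai α θ f a) = coeff (embed α n g) vacuum a := by
  have : coeff (embed α n g) vacuum ∘L (anzai α θ f).toCLM = coeff (embed α n g) vacuum := by
    refine clm_ext_term fun h m => ?_
    change coeff (embed α n g) vacuum (anzai α θ f (term α h m)) = _
    rw [anzai_term, coeff_apply, coeff_apply, inner_embed_term, inner_embed_term]
    split_ifs with hm
    · rw [hm, solvesCohomological_iff.1 hg]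
    · rfl
  exact DFunLike.congr_fun this a

/-- The functional `Re ⟨x, π (·) δ_{0, 0}⟩`. -/
def realCoeff (x : EllTwo) : NCTorus α →L[ℂ] ℂ :=
  (2⁻¹ : ℂ) • (coeff x vacuum + coeff vacuum x)

theorem realCoeff_apply (x : EllTwo) (a : NCTorus α) :
    realCoeff x a = 2⁻¹ * (coeff x vacuum a + coeff vacuum x a) := rfl

theorem realCoeff_neg (x : EllTwo) : (realCoeff (-x) : NCTorus α →L[ℂ] ℂ) = -realCoeff x := by
  ext a
  simp only [realCoeff_apply, coeff_apply, neg_apply, inner_neg_left,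
    map_neg, inner_neg_right]
  ring

/-- Positivity holds because the functional is half of `⟨Ω + x, π(·)(Ω + x)⟩`: the two diagonal
terms are both `τ`. Orthogonality of `x` and `Ω` gives the normalisation. -/
theorem trace_add_realCoeff_mem_invariantStates {x : EllTwo} (hx : coeff x x = trace α)
    (h1 : inner ℂ x vacuum = 0)
    (hinv : ∀ a, coeff x vacuum (anzai α θ f a) = coeff x vacuum a) :
    trace α + realCoeff x ∈ invariantStates (anzai α θ f) := by
  have hinv' : ∀ a, coeff vacuum x (anzai α θ f a) = coeff vacuum x a := fun a => by
    rw [← star_star a, map_star, coeff_star, coeff_star, hinv]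
  refine ⟨⟨?_, fun a => ?_⟩, fun a => ?_⟩
  · rw [add_apply, trace_mem_states.1, realCoeff_apply, coeff_apply, coeff_apply, map_one]
    change 1 + 2⁻¹ * (inner ℂ x vacuum + inner ℂ vacuum x) = 1
    rw [← inner_conj_symm vacuum x, h1]
    simp
  · have h2 : (trace α + realCoeff x : NCTorus α →L[ℂ] ℂ) (star a * a) =
        2⁻¹ * coeff (vacuum + x) (vacuum + x) (star a * a) := by
      have h3 := DFunLike.congr_fun hx (star a * a)
      have h4 : coeff (vacuum + x) (vacuum + x) (star a * a) =
          coeff vacuum vacuum (star a * a) + coeff vacuum x (star a * a) +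
            (coeff x vacuum (star a * a) + coeff x x (star a * a)) := by
        simp only [coeff_apply, map_add, inner_add_left, inner_add_right]
        ring
      rw [h4, h3, ← trace_eq_coeff, add_apply, realCoeff_apply]
      ring
    rw [h2]
    refine mul_nonneg ?_ (coeff_self_nonneg _ _)
    rw [← Complex.ofReal_ofNat, ← Complex.ofReal_inv]
    exact Complex.zero_le_real.2 (by norm_num)
  · rw [add_apply, add_apply, realCoeff_apply, realCoeff_apply, hinv, hinv',
      (trace_mem_invariantStates θ f).2]

theorem not_solvesCohomological_of_isErgodicState (hθ : Irrational (θ / (2 * Real.pi)))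
    (H : IsErgodicState (anzai α θ f) (trace α)) {n : ℤ} (hn : n ≠ 0)
    {g : Lp ℂ 2 Circle.lebesgue} (hg : SolvesCohomological α θ f n g) (hg1 : ‖g‖ = 1) : False := by
  have hx := coeff_embed_eq_trace hθ hg hg1
  have hx' : coeff (-embed α n g) (-embed α n g) = trace α := by
    rw [← hx]; ext a; simp [coeff_apply]
  have h1 : inner ℂ (embed α n g) vacuum = 0 := by
    have := inner_embed_term (α := α) n 0 g 1
    rw [term_one_zero, map_one, if_neg hn.symm] at this
    exact this
  have hinv := coeff_embed_vacuum_anzai hg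
  have hp := trace_add_realCoeff_mem_invariantStates hx h1 hinv
  -- The hypotheses are insensitive to the sign of `x`, so `τ` is the midpoint of the invariant
  -- states for `x` and `-x`.
  have hm := trace_add_realCoeff_mem_invariantStates (f := f) (θ := θ) hx' (by simp [h1])
    fun a => by
      have := hinv a
      rw [coeff_apply, coeff_apply] at this ⊢
      rw [inner_neg_left, inner_neg_left, this]
  have h0 := H.2 hp hm ⟨2⁻¹, 2⁻¹, by norm_num, by norm_num, by norm_num, by
    rw [realCoeff_neg]; module⟩
  have h2 : (realCoeff (embed α n g) : NCTorus α →L[ℂ] ℂ) = 0 := add_eq_left.1 h0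
  have h3 : g = 0 := by
    refine Circle.denseRange_toL2.eq_of_inner_left ℂ fun h => ?_
    have := DFunLike.congr_fun h2 (term α h n)
    -- On the fibre `n` the second summand vanishes because `n + n ≠ 0`; what remains is half of
    -- `⟨g, h⟩`, so `g` is orthogonal to all continuous `h`.
    rw [realCoeff_apply, coeff_vacuum_embed_term (by omega), coeff_apply, inner_embed_term,
      if_pos rfl] at this
    simpa using this
  simp [h3] at hg1

theorem _root_.SolvesCohomological.smul {n : ℤ} {g : Lp ℂ 2 Circle.lebesgue} (c : ℂ)
    (hg : SolvesCohomological α θ f n g) : SolvesCohomological α θ f n (c • g) :=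
  solvesCohomological_iff.2 fun h => by
    rw [inner_smul_left, inner_smul_left, solvesCohomological_iff.1 hg]

end NCTorus

end

theorem mainTheorem4 (α θ : ℝ) (hθ : Irrational (θ / (2 * Real.pi))) (f : C(Circle, Circle)) :
    List.TFAE [
      IsErgodicState (NCTorus.anzai α θ f) (NCTorus.trace α),
      ∀ n : ℤ, n ≠ 0 → ¬ ∃ g : MeasureTheory.Lp ℂ 2 Circle.lebesgue,
        g ≠ 0 ∧ SolvesCohomological α θ f n g,
      IsUniquelyErgodic (NCTorus.anzai α θ f)] := by
  tfae_have 1 → 2 := by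
    rintro H n hn ⟨g, hg0, hg⟩
    exact NCTorus.not_solvesCohomological_of_isErgodicState hθ H hn (hg.smul ((‖g‖ : ℂ)⁻¹))
      (norm_smul_inv_norm hg0)
  tfae_have 2 → 3 := NCTorus.isUniquelyErgodic_of_forall_not_solvesCohomological hθ
  tfae_have 3 → 1 := NCTorus.isErgodicState_trace_of_isUniquelyErgodic
  tfae_finish
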